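/- Let $K$ be a strict 2-category. A 1-arrow $f\colon x\to y$ is *ff* if $f_*\colon K(z,x)\to K(z,y)$ is fully faithful for every object $z$. A *strict 2-site* structure on $K$ is a class $\mathsf J$ of ff 1-arrows (called *covers*) which contains the identities and is closed under composition, together with a specified strict pullback of each $j\in\mathsf J$ along every 1-arrow with the same codomain, the pulled-back arrow again lying in $\mathsf J$, such that every $j\colon u\to x$ in $\mathsf J$ is strictly 2-regular: for all $f,g\colon x\to y$, every 2-arrow $fj\Rightarrow gj$ whose whiskerings with the two projections $u\times_x u\to u$ are equal is of the form $a\,j$ (the whiskering of $a$ with $j$) for a unique $a\colon f\Rightarrow g$. A *$\mathsf J$-fraction* from $x$ to $y$ is a span $x\xleftarrow{j}u\xrightarrow{f}y$ with $j\in\mathsf J$, denoted $(j,f)$. A *map of fractions* from $(j,f)$ to $(k,g)$, where $k\colon v\to x$, is a 2-arrow $f\circ\mathrm{pr}_1\Rightarrow g\circ\mathrm{pr}_2$ on $u\times_x v$. For maps $t_1\colon(j_1,f_1)\to(j_2,f_2)$ and $t_2\colon(j_2,f_2)\to(j_3,f_3)$, where $j_i\colon u_i\to x$, the composite is the unique 2-arrow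 on $u_1\times_x u_3$ whose whiskering with the cover $u_1\times_x u_2\times_x u_3\to u_1\times_x u_3$ is the composite of the whiskerings of $t_1$ and $t_2$ with the projections to $u_1\times_x u_2$ and $u_2\times_x u_3$. The identity of $(j,f)$ is the whiskering with $f$ of the unique 2-arrow $\mathrm{pr}_1\Rightarrow\mathrm{pr}_2\colon u\times_x u\to u$ whose whiskering with $j$ is an identity. Fractions from $x$ to $y$ and their maps form a category $K_{\mathsf J}(x,y)$, the hom-category of the bicategory of fractions $K_{\mathsf J}$, whose objects are those of $K$. Let $W_{\mathsf J}$ be the class of ff 1-arrows $q\colon x\to y$ for which there are a cover $j\colon u\to y$, a 1-arrow $s\colon u\to x$ and an invertible 2-arrow $q s\cong j$. A *localisation* of $K$ at $W_{\mathsf J}$ is a bicategory $L$ with a pseudofunctor $Q\colon K\to L$ sending $W_{\mathsf J}$ to equivalences such that, for every bicategory $A$, precomposition with $Q$ is a biequivalence from the bicategory $\mathbf{Bicat}(L,A)$ of pseudofunctors, pseudonatural transformations and modifications to the full sub-bicategory of $\mathbf{Bicat}(K,A)$ on the pseudofunctors sending $W_{\mathsf J}$ to equivalences. A bicategory is *locally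 essentially small* if each of its hom-categories is equivalent to a small category. **Proposition.** Suppose that $K$ is locally essentially small and that $(K,\mathsf J)$ satisfies WISC: every object $x$ has a set of covers $(p_i\colon c_i\to x)_{i\in I}$ such that for every cover $j\colon u\to x$ there are $i\in I$ and $a\colon c_i\to u$ with $j a=p_i$. Then $K_{\mathsf J}$ is locally essentially small, and every localisation of $K$ at $W_{\mathsf J}$ is locally essentially small. -/

import Mathlib

open CategoryTheory Bicategory

universe s w v u w' v' u'

namespace TwoSite

/-! ### Arrows in a strict 2-category -/

section Arrows

variable {K : Type u} [Bicategory.{w, v} K]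

/-- A class of 1-arrows of a bicategory. -/
abbrev ArrowClass (K : Type u) [Bicategory.{w, v} K] := ∀ ⦃x y : K⦄, (x ⟶ y) → Prop

/-- A 1-arrow `f : x ⟶ y` is (representably) fully faithful if for all `g h : z ⟶ x` whiskering
with `f` is a bijection from 2-arrows `g ⟶ h` to 2-arrows `g ≫ f ⟶ h ≫ f`. -/
def IsFF {x y : K} (f : x ⟶ y) : Prop :=
  ∀ ⦃z : K⦄ (g h : z ⟶ x), Function.Bijective (fun a : g ⟶ h => a ▷ f)

/-- A 1-arrow is an equivalence if it has a pseudo-inverse. -/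
def IsEquiv {x y : K} (f : x ⟶ y) : Prop :=
  ∃ g : y ⟶ x, Nonempty (f ≫ g ≅ 𝟙 x) ∧ Nonempty (g ≫ f ≅ 𝟙 y)

/-- A bicategory is locally essentially small if all its hom-categories are equivalent to small
categories. -/
def LocallyEssentiallySmall (K : Type u) [Bicategory.{w, v} K] : Prop :=
  ∀ x y : K, EssentiallySmall.{s} (x ⟶ y)

/-- Let `p₁ p₂ : r ⟶ u` be the kernel pair of `p : u ⟶ x`. Then `p` is strictly 2-regular if
every 2-arrow `b : p ≫ f ⟶ p ≫ g` whose whiskerings with `p₁` and `p₂` agree is of the form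
`p ◁ a` for a unique `a : f ⟶ g`. The 2-arrows `eqToHom _` only identify the equal 1-arrows
`p₁ ≫ p ≫ f` and `p₂ ≫ p ≫ f`. In other words, precomposition with `p` is fully faithful as a
functor into strict descent data. -/
def IsStrictlyTwoRegular [Bicategory.Strict K] {u x r : K} (p : u ⟶ x) (p₁ p₂ : r ⟶ u)
    (h : p₁ ≫ p = p₂ ≫ p) : Prop :=
  ∀ ⦃y : K⦄ (f g : x ⟶ y) (b : p ≫ f ⟶ p ≫ g),
    p₁ ◁ b ≫ eqToHom (by rw [← Strict.assoc, h, Strict.assoc]) =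
      eqToHom (by rw [← Strict.assoc, h, Strict.assoc]) ≫ p₂ ◁ b →
    ∃! a : f ⟶ g, p ◁ a = b

end Arrows

/-! ### Localisations of bicategories -/

section Localisation

open scoped Pseudofunctor.StrongTrans

universe w₁ v₁ u₁ w₂ v₂ u₂ w₃ v₃ u₃

/-- A pseudofunctor is a biequivalence if it is surjective on objects up to equivalence and
induces equivalences of hom-categories. -/
def IsBiequivalence {B : Type u₁} [Bicategory.{w₁, v₁} B] {C : Type u₂} [Bicategory.{w₂, v₂} C]
    (F : B ⥤ᵖ C) : Prop :=
  (∀ c : C, ∃ b : B, Nonempty (F.obj b ≌ c)) ∧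
    ∀ a b : B, (F.mapFunctor a b).IsEquivalence

variable {B : Type u₁} [Bicategory.{w₁, v₁} B] {L : Type u₂} [Bicategory.{w₂, v₂} L]

/-- The pseudofunctor `F` sends the arrows in `W` to equivalences. -/
def Inverts (W : ArrowClass B) (F : B ⥤ᵖ L) : Prop :=
  ∀ ⦃x y : B⦄ (f : x ⟶ y), W f → IsEquiv (F.map f)

theorem IsEquiv.map {x y : B} {f : x ⟶ y} (hf : IsEquiv f) (F : B ⥤ᵖ L) :
    IsEquiv (F.map f) := by
  obtain ⟨g, ⟨e⟩, ⟨e'⟩⟩ := hf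
  exact ⟨F.map g, ⟨(F.mapComp f g).symm ≪≫ F.map₂Iso e ≪≫ F.mapId x⟩,
    ⟨(F.mapComp g f).symm ≪≫ F.map₂Iso e' ≪≫ F.mapId y⟩⟩

theorem Inverts.comp {W : ArrowClass B} {Q : B ⥤ᵖ L} (hQ : Inverts W Q)
    {A : Type u₃} [Bicategory.{w₃, v₃} A] (G : L ⥤ᵖ A) : Inverts W (Q.comp G) :=
  fun _ _ f hf => (hQ f hf).map G

/-- The full sub-bicategory of the bicategory of pseudofunctors, pseudonatural transformations
and modifications from `B` to `A`, on the pseudofunctors sending `W` to equivalences. -/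
abbrev BicatInverting (W : ArrowClass B) (A : Type u₃) [Bicategory.{w₃, v₃} A] :=
  InducedBicategory (B ⥤ᵖ A) (fun F : {F : B ⥤ᵖ A // Inverts W F} => F.1)

/-- Precomposition of a pseudonatural transformation with a pseudofunctor. -/
@[simps]
def precompTrans (Q : B ⥤ᵖ L) {A : Type u₃} [Bicategory.{w₃, v₃} A] {G H : L ⥤ᵖ A} (η : G ⟶ H) :
    Q.comp G ⟶ Q.comp H where
  app x := η.app (Q.obj x)
  naturality f := η.naturality (Q.map f)
  naturality_naturality a := η.naturality_naturality (Q.map₂ a)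
  naturality_id x := by
    change (η.naturality (Q.map (𝟙 x))).hom ≫
        η.app (Q.obj x) ◁ (H.map₂ (Q.mapId x).hom ≫ (H.mapId (Q.obj x)).hom) =
      (G.map₂ (Q.mapId x).hom ≫ (G.mapId (Q.obj x)).hom) ▷ η.app (Q.obj x) ≫
        (λ_ (η.app (Q.obj x))).hom ≫ (ρ_ (η.app (Q.obj x))).inv
    rw [whiskerLeft_comp, comp_whiskerRight, Category.assoc, ← η.naturality_id,
      ← η.naturality_naturality_assoc]
  naturality_comp {a b c} f g := by
    change (η.naturality (Q.map (f ≫ g))).hom ≫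
        η.app (Q.obj a) ◁ (H.map₂ (Q.mapComp f g).hom ≫ (H.mapComp (Q.map f) (Q.map g)).hom) =
      (G.map₂ (Q.mapComp f g).hom ≫ (G.mapComp (Q.map f) (Q.map g)).hom) ▷ η.app (Q.obj c) ≫
        (α_ _ _ _).hom ≫ G.map (Q.map f) ◁ (η.naturality (Q.map g)).hom ≫
        (α_ _ _ _).inv ≫ (η.naturality (Q.map f)).hom ▷ H.map (Q.map g) ≫ (α_ _ _ _).hom
    rw [whiskerLeft_comp, comp_whiskerRight, Category.assoc, ← η.naturality_comp,
      ← η.naturality_naturality_assoc]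

/-- Precomposition of a modification with a pseudofunctor. -/
@[simps]
def precompModif (Q : B ⥤ᵖ L) {A : Type u₃} [Bicategory.{w₃, v₃} A] {G H : L ⥤ᵖ A}
    {η θ : G ⟶ H} (Γ : η ⟶ θ) : precompTrans Q η ⟶ precompTrans Q θ where
  as :=
    { app x := Γ.as.app (Q.obj x)
      naturality f := Γ.as.naturality (Q.map f) }

/-- Precomposition preserves identities. -/
def precompId (Q : B ⥤ᵖ L) {A : Type u₃} [Bicategory.{w₃, v₃} A] (G : L ⥤ᵖ A) :
    precompTrans Q (𝟙 G) ≅ 𝟙 (Q.comp G) :=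
  Pseudofunctor.StrongTrans.isoMk (fun _ => Iso.refl _) (fun {a b} f => by
    change _ ◁ 𝟙 _ ≫ ((𝟙 G : G ⟶ G).naturality (Q.map f)).hom = ((𝟙 G : G ⟶ G).naturality (Q.map f)).hom ≫ 𝟙 _ ▷ _
    rw [whiskerLeft_id, id_whiskerRight, Category.id_comp, Category.comp_id])

/-- Precomposition preserves composition. -/
def precompComp (Q : B ⥤ᵖ L) {A : Type u₃} [Bicategory.{w₃, v₃} A] {G H I : L ⥤ᵖ A}
    (η : G ⟶ H) (θ : H ⟶ I) :
    precompTrans Q (η ≫ θ) ≅ precompTrans Q η ≫ precompTrans Q θ :=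
  Pseudofunctor.StrongTrans.isoMk (fun _ => Iso.refl _) (fun {a b} f => by
    change _ ◁ 𝟙 _ ≫ ((η ≫ θ).naturality (Q.map f)).hom = ((η ≫ θ).naturality (Q.map f)).hom ≫ 𝟙 _ ▷ _
    rw [whiskerLeft_id, id_whiskerRight, Category.id_comp, Category.comp_id])

/-- Precomposition with a pseudofunctor `Q` inverting `W`, as a pseudofunctor. -/
def precomposition {W : ArrowClass B} {Q : B ⥤ᵖ L} (hQ : Inverts W Q)
    (A : Type u₃) [Bicategory.{w₃, v₃} A] : (L ⥤ᵖ A) ⥤ᵖ BicatInverting W A where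
  obj G := ⟨Q.comp G, hQ.comp G⟩
  map η := InducedBicategory.mkHom (precompTrans Q η)
  map₂ Γ := ⟨precompModif Q Γ⟩
  mapId G := InducedBicategory.isoMk (precompId Q G)
  mapComp η θ := InducedBicategory.isoMk (precompComp Q η θ)
  map₂_id _ := rfl
  map₂_comp _ _ := rfl
  map₂_whisker_left η θ ι Γ := by
    apply InducedBicategory.hom₂_ext
    apply Pseudofunctor.StrongTrans.homCategory.ext
    intro x
    change η.app (Q.obj x) ◁ Γ.as.app (Q.obj x) =
      𝟙 _ ≫ η.app (Q.obj x) ◁ Γ.as.app (Q.obj x) ≫ 𝟙 _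
    rw [Category.comp_id, Category.id_comp]
  map₂_whisker_right Γ η := by
    apply InducedBicategory.hom₂_ext
    apply Pseudofunctor.StrongTrans.homCategory.ext
    intro x
    change Γ.as.app (Q.obj x) ▷ η.app (Q.obj x) =
      𝟙 _ ≫ Γ.as.app (Q.obj x) ▷ η.app (Q.obj x) ≫ 𝟙 _
    rw [Category.comp_id, Category.id_comp]
  map₂_associator η θ ι := by
    apply InducedBicategory.hom₂_ext
    apply Pseudofunctor.StrongTrans.homCategory.ext
    intro x
    change (α_ (η.app (Q.obj x)) (θ.app (Q.obj x)) (ι.app (Q.obj x))).hom =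
      𝟙 _ ≫ 𝟙 _ ▷ _ ≫ (α_ (η.app (Q.obj x)) (θ.app (Q.obj x)) (ι.app (Q.obj x))).hom ≫
        _ ◁ 𝟙 _ ≫ 𝟙 _
    simp
  map₂_left_unitor η := by
    apply InducedBicategory.hom₂_ext
    apply Pseudofunctor.StrongTrans.homCategory.ext
    intro x
    change (λ_ (η.app (Q.obj x))).hom = 𝟙 _ ≫ 𝟙 _ ▷ _ ≫ (λ_ (η.app (Q.obj x))).hom
    simp
  map₂_right_unitor η := by
    apply InducedBicategory.hom₂_ext
    apply Pseudofunctor.StrongTrans.homCategory.ext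
    intro x
    change (ρ_ (η.app (Q.obj x))).hom = 𝟙 _ ≫ _ ◁ 𝟙 _ ≫ (ρ_ (η.app (Q.obj x))).hom
    simp

/-- `Q` is a localisation of `B` at `W`: it sends `W` to equivalences, and for every bicategory
`A` precomposition with `Q` is a biequivalence onto the bicategory of pseudofunctors `B ⥤ᵖ A`
sending `W` to equivalences. The first three universe levels are those of `A`: objects, 1-arrows
and 2-arrows. -/
def IsLocalisation.{a₁, a₂, a₃, b₁, b₂, b₃, c₁, c₂, c₃} {B : Type b₁} [Bicategory.{b₃, b₂} B]
    {L : Type c₁} [Bicategory.{c₃, c₂} L] (W : ArrowClass B) (Q : B ⥤ᵖ L) : Prop :=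
  ∃ hQ : Inverts W Q, ∀ (A : Type a₁) [Bicategory.{a₃, a₂} A],
    IsBiequivalence (precomposition hQ A)

end Localisation

/-! ### Strict 2-sites -/

/-- A singleton strict pretopology: a class of 1-arrows containing the identities, closed under
composition, with specified strict pullbacks of its elements along arbitrary 1-arrows, which are
again elements. -/
structure StrictPretopology (K : Type u) [Bicategory.{w, v} K] [Bicategory.Strict K] where
  /-- the covers -/
  J : ArrowClass K
  id_mem (x : K) : J (𝟙 x)
  comp_mem {x y z : K} (f : x ⟶ y) (g : y ⟶ z) : J f → J g → J (f ≫ g)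
  /-- the specified pullback of the cover `j` along `f` -/
  pb {u x y : K} (j : u ⟶ x) (hj : J j) (f : y ⟶ x) : K
  /-- the projection to the domain of the cover -/
  fst {u x y : K} (j : u ⟶ x) (hj : J j) (f : y ⟶ x) : pb j hj f ⟶ u
  /-- the projection to the domain of the other arrow -/
  snd {u x y : K} (j : u ⟶ x) (hj : J j) (f : y ⟶ x) : pb j hj f ⟶ y
  isPullback {u x y : K} (j : u ⟶ x) (hj : J j) (f : y ⟶ x) :
    IsPullback (fst j hj f) (snd j hj f) j f
  snd_mem {u x y : K} (j : u ⟶ x) (hj : J j) (f : y ⟶ x) : J (snd j hj f)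

/-- A strict 2-site structure on a strict 2-category: a totally strict subcanonical singleton
pretopology all of whose elements are fully faithful. -/
structure StrictTwoSite (K : Type u) [Bicategory.{w, v} K] [Bicategory.Strict K] extends
    StrictPretopology K where
  subcanonical {u x : K} (j : u ⟶ x) (hj : J j) :
    IsStrictlyTwoRegular j (fst j hj j) (snd j hj j) (isPullback j hj j).w
  ff {u x : K} (j : u ⟶ x) : J j → IsFF j

variable {K : Type u} [Bicategory.{w, v} K] [Bicategory.Strict K]

/-- The condition WISC: every object has a small set of covers that is weakly initial among all
its covers. -/
def WISC (S : StrictTwoSite K) : Prop :=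
  ∀ x : K, ∃ (I : Type s) (c : I → K) (p : ∀ i, c i ⟶ x), (∀ i, S.J (p i)) ∧
    ∀ (u : K) (j : u ⟶ x), S.J j → ∃ (i : I) (a : c i ⟶ u), a ≫ j = p i

/-- `q : x ⟶ y` is locally split if some cover `u ⟶ y` lifts through `q` up to an invertible
2-arrow. -/
def IsLocallySplit (S : StrictTwoSite K) {x y : K} (q : x ⟶ y) : Prop :=
  ∃ (u : K) (j : u ⟶ y) (r : u ⟶ x), S.J j ∧ Nonempty (r ≫ q ≅ j)

/-- The class `W_J` of weak equivalences: the locally split fully faithful arrows. -/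
def weakEquivalences (S : StrictTwoSite K) : ArrowClass K :=
  fun _ _ q => IsFF q ∧ IsLocallySplit S q

/-! ### Canonical 2-arrows and descent -/

section Cells

attribute [local simp] Strict.associator_eqToIso Strict.leftUnitor_eqToIso
  Strict.rightUnitor_eqToIso

/-- The unique 2-arrow between two lifts of the same arrow through a fully faithful arrow. -/
noncomputable def canon {w u x : K} {j : u ⟶ x} (hj : IsFF j) {a b : w ⟶ u}
    (h : a ≫ j = b ≫ j) : a ⟶ b :=
  ((hj a b).2 (eqToHom h)).choose

theorem canon_whisker {w u x : K} {j : u ⟶ x} (hj : IsFF j) {a b : w ⟶ u}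
    (h : a ≫ j = b ≫ j) : canon hj h ▷ j = eqToHom h :=
  ((hj a b).2 (eqToHom h)).choose_spec

theorem canon_unique {w u x : K} {j : u ⟶ x} (hj : IsFF j) {a b : w ⟶ u}
    {h : a ≫ j = b ≫ j} (c : a ⟶ b) (hc : c ▷ j = eqToHom h) : c = canon hj h :=
  (hj a b).1 (hc.trans (canon_whisker hj h).symm)

theorem canon_refl {w u x : K} {j : u ⟶ x} (hj : IsFF j) {a : w ⟶ u} (h : a ≫ j = a ≫ j) :
    canon hj h = 𝟙 a :=
  (canon_unique hj (h := h) (𝟙 a) (by simp)).symm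

theorem canon_precomp {w' w u x : K} {j : u ⟶ x} (hj : IsFF j) {a b : w ⟶ u}
    (h : a ≫ j = b ≫ j) (c : w' ⟶ w) (h' : (c ≫ a) ≫ j = (c ≫ b) ≫ j) :
    c ◁ canon hj h = canon hj h' := by
  apply canon_unique
  simp [canon_whisker]

/-- Covers satisfy descent for arbitrary 2-arrows. -/
theorem descent (S : StrictTwoSite K) {u x y : K} {j : u ⟶ x} (hj : S.J j) {f g : x ⟶ y}
    (b : j ≫ f ⟶ j ≫ g) : ∃! a : f ⟶ g, j ◁ a = b := by
  apply S.subcanonical j hj f g b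
  have hw := (S.isPullback j hj j).w
  have h := whisker_exchange (canon (S.ff j hj) hw) b
  have e : ∀ k : x ⟶ y, canon (S.ff j hj) hw ▷ (j ≫ k) =
      eqToHom (by rw [← Strict.assoc, hw, Strict.assoc]) := by
    intro k
    have := canon_whisker (S.ff j hj) hw
    simp [whiskerRight_comp, this]
  rw [e, e] at h
  exact h

end Cells

/-! ### Fractions -/

/-- A fraction from `x` to `y`: a span `x ⟵ u ⟶ y` whose left leg is a cover. -/
structure Fraction (S : StrictTwoSite K) (x y : K) where
  /-- the vertex `u` -/
  obj : K
  /-- the left leg -/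
  left : obj ⟶ x
  mem : S.J left
  /-- the right leg -/
  right : obj ⟶ y

namespace Fraction

variable {S : StrictTwoSite K} {x y : K}

/-- The specified pullback `u ×ₓ v` of the left legs of two fractions. -/
abbrev P (A B : Fraction S x y) : K := S.pb A.left A.mem B.left

/-- The projection `u ×ₓ v ⟶ u`. -/
abbrev p₁ (A B : Fraction S x y) : P A B ⟶ A.obj := S.fst A.left A.mem B.left

/-- The projection `u ×ₓ v ⟶ v`. -/
abbrev p₂ (A B : Fraction S x y) : P A B ⟶ B.obj := S.snd A.left A.mem B.left

theorem w (A B : Fraction S x y) : p₁ A B ≫ A.left = p₂ A B ≫ B.left :=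
  (S.isPullback A.left A.mem B.left).w

/-- A map of fractions `(j, f) ⟶ (k, g)`: a 2-arrow from `u ×ₓ v ⟶ u ⟶ y` to
`u ×ₓ v ⟶ v ⟶ y`. -/
@[ext]
structure Hom (A B : Fraction S x y) where
  /-- the underlying 2-arrow -/
  cell : p₁ A B ≫ A.right ⟶ p₂ A B ≫ B.right

section

attribute [local simp] Strict.associator_eqToIso Strict.leftUnitor_eqToIso
  Strict.rightUnitor_eqToIso

variable {A B C D : Fraction S x y}

/-- The arrow `z ⟶ u ×ₓ v` with components `a` and `b`. -/
noncomputable def pair {z : K} (a : z ⟶ A.obj) (b : z ⟶ B.obj) (h : a ≫ A.left = b ≫ B.left) :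
    z ⟶ P A B :=
  (S.isPullback A.left A.mem B.left).lift a b h

theorem pair_p₁ {z : K} (a : z ⟶ A.obj) (b : z ⟶ B.obj) (h : a ≫ A.left = b ≫ B.left) :
    pair a b h ≫ p₁ A B = a :=
  (S.isPullback A.left A.mem B.left).lift_fst a b h

theorem pair_p₂ {z : K} (a : z ⟶ A.obj) (b : z ⟶ B.obj) (h : a ≫ A.left = b ≫ B.left) :
    pair a b h ≫ p₂ A B = b :=
  (S.isPullback A.left A.mem B.left).lift_snd a b h

/-- The whiskering of a map of fractions with the arrow `z ⟶ u ×ₓ v` with components `a`, `b`. -/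
noncomputable def Hom.app (t : Hom A B) {z : K} (a : z ⟶ A.obj) (b : z ⟶ B.obj)
    (h : a ≫ A.left = b ≫ B.left) : a ≫ A.right ⟶ b ≫ B.right :=
  eqToHom (by rw [← Strict.assoc, pair_p₁]) ≫ pair a b h ◁ t.cell ≫
    eqToHom (by rw [← Strict.assoc, pair_p₂])

theorem Hom.app_eq (t : Hom A B) {z : K} (a : z ⟶ A.obj) (b : z ⟶ B.obj)
    (h : a ≫ A.left = b ≫ B.left) (l : z ⟶ P A B) (ha : l ≫ p₁ A B = a) (hb : l ≫ p₂ A B = b) :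
    t.app a b h = eqToHom (by rw [← Strict.assoc, ha]) ≫ l ◁ t.cell ≫
      eqToHom (by rw [← Strict.assoc, hb]) := by
  have : l = pair a b h := by
    apply (S.isPullback A.left A.mem B.left).hom_ext
    · exact ha.trans (pair_p₁ a b h).symm
    · exact hb.trans (pair_p₂ a b h).symm
  subst this
  rfl

theorem Hom.app_self (t : Hom A B) : t.app (p₁ A B) (p₂ A B) (w A B) = t.cell := by
  rw [t.app_eq _ _ _ (𝟙 _) (Strict.id_comp _) (Strict.id_comp _)]
  simp [id_whiskerLeft]

theorem Hom.app_precomp (t : Hom A B) {z' z : K} (c : z' ⟶ z) (a : z ⟶ A.obj) (b : z ⟶ B.obj)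
    (h : a ≫ A.left = b ≫ B.left) (h' : (c ≫ a) ≫ A.left = (c ≫ b) ≫ B.left) :
    t.app (c ≫ a) (c ≫ b) h' =
      eqToHom (Strict.assoc _ _ _) ≫ c ◁ t.app a b h ≫ eqToHom (Strict.assoc _ _ _).symm := by
  rw [t.app_eq a b h (pair a b h) (pair_p₁ a b h) (pair_p₂ a b h),
    t.app_eq (c ≫ a) (c ≫ b) h' (c ≫ pair a b h) (by rw [Strict.assoc, pair_p₁])
      (by rw [Strict.assoc, pair_p₂])]
  simp [comp_whiskerLeft]

theorem Hom.app_precomp' (t : Hom A B) {z' z : K} (c : z' ⟶ z) (a : z ⟶ A.obj) (b : z ⟶ B.obj)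
    (h : a ≫ A.left = b ≫ B.left) (a' : z' ⟶ A.obj) (b' : z' ⟶ B.obj)
    (h' : a' ≫ A.left = b' ≫ B.left) (ha : c ≫ a = a') (hb : c ≫ b = b') :
    t.app a' b' h' = eqToHom (by rw [← ha, Strict.assoc]) ≫ c ◁ t.app a b h ≫
      eqToHom (by rw [← hb, Strict.assoc]) := by
  subst ha hb
  exact t.app_precomp c a b h h'

/-- A map of fractions is determined by its whiskering with any cover. -/
theorem Hom.ext_of_cover {t t' : Hom A B} {z : K} (q : z ⟶ P A B) (hq : S.J q)
    (e : t.app (q ≫ p₁ A B) (q ≫ p₂ A B) (by rw [Strict.assoc, Strict.assoc, w]) =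
      t'.app (q ≫ p₁ A B) (q ≫ p₂ A B) (by rw [Strict.assoc, Strict.assoc, w])) : t = t' := by
  rw [t.app_precomp q _ _ (w A B), t'.app_precomp q _ _ (w A B)] at e
  simp only [Hom.app_self, cancel_epi, cancel_mono] at e
  exact Hom.ext ((descent S hq (q ◁ t'.cell)).unique e rfl)

variable (A B C) in
/-- The triple pullback `v ×ₓ (u ×ₓ w)` of the left legs of three fractions. -/
abbrev T : K := S.pb B.left B.mem (p₁ A C ≫ A.left)

variable (A B C) in
/-- The projection `v ×ₓ (u ×ₓ w) ⟶ u ×ₓ w`, which is a cover. -/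
abbrev p₁₃ : T A B C ⟶ P A C := S.snd B.left B.mem (p₁ A C ≫ A.left)

variable (A B C) in
/-- The projection `v ×ₓ (u ×ₓ w) ⟶ v`. -/
abbrev pm : T A B C ⟶ B.obj := S.fst B.left B.mem (p₁ A C ≫ A.left)

theorem w₁ (A B C : Fraction S x y) : (p₁₃ A B C ≫ p₁ A C) ≫ A.left = pm A B C ≫ B.left := by
  rw [Strict.assoc]
  exact (S.isPullback B.left B.mem (p₁ A C ≫ A.left)).w.symm

theorem w₃ (A B C : Fraction S x y) : pm A B C ≫ B.left = (p₁₃ A B C ≫ p₂ A C) ≫ C.left := by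
  rw [← w₁, Strict.assoc, Strict.assoc, w]

/-- The precomposition of two maps of fractions, a 2-arrow on the triple pullback. -/
noncomputable def precomp (t : Hom A B) (t' : Hom B C) :
    p₁₃ A B C ≫ p₁ A C ≫ A.right ⟶ p₁₃ A B C ≫ p₂ A C ≫ C.right :=
  eqToHom (Strict.assoc _ _ _).symm ≫ t.app _ _ (w₁ A B C) ≫ t'.app _ _ (w₃ A B C) ≫
    eqToHom (Strict.assoc _ _ _)

/-- The composition of maps of fractions: the unique descent of their precomposition along the
cover `p₁₃`. -/
noncomputable def comp (t : Hom A B) (t' : Hom B C) : Hom A C where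
  cell := (descent S (S.snd_mem B.left B.mem (p₁ A C ≫ A.left)) (precomp t t')).choose

theorem comp_spec (t : Hom A B) (t' : Hom B C) :
    p₁₃ A B C ◁ (comp t t').cell = precomp t t' :=
  (descent S (S.snd_mem B.left B.mem (p₁ A C ≫ A.left)) (precomp t t')).choose_spec.1

/-- The identity map of a fraction: the canonical 2-arrow `p₁ ⟶ p₂` followed by the right leg. -/
noncomputable def id (A : Fraction S x y) : Hom A A where
  cell := canon (S.ff _ A.mem) (w A A) ▷ A.right

theorem id_app {z : K} (a b : z ⟶ A.obj) (h : a ≫ A.left = b ≫ A.left) :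
    (id A).app a b h = canon (S.ff _ A.mem) h ▷ A.right := by
  obtain ⟨l, rfl, rfl⟩ : ∃ l : z ⟶ P A A, l ≫ p₁ A A = a ∧ l ≫ p₂ A A = b :=
    ⟨_, pair_p₁ a b h, pair_p₂ a b h⟩
  rw [Hom.app_precomp _ l _ _ (w A A), Hom.app_self, ← canon_precomp _ (w A A)]
  simp [id]

theorem comp_app (t : Hom A B) (t' : Hom B C) {z : K} (a : z ⟶ A.obj) (b : z ⟶ B.obj)
    (c : z ⟶ C.obj) (h : a ≫ A.left = b ≫ B.left) (h' : b ≫ B.left = c ≫ C.left) :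
    (comp t t').app a c (h.trans h') = t.app a b h ≫ t'.app b c h' := by
  obtain ⟨l, rfl, rfl⟩ : ∃ l : z ⟶ P A C, l ≫ p₁ A C = a ∧ l ≫ p₂ A C = c :=
    ⟨_, pair_p₁ a c (h.trans h'), pair_p₂ a c (h.trans h')⟩
  obtain ⟨r, rfl, rfl⟩ : ∃ r : z ⟶ T A B C, r ≫ pm A B C = b ∧ r ≫ p₁₃ A B C = l :=
    ⟨(S.isPullback B.left B.mem (p₁ A C ≫ A.left)).lift b l
      (by rw [← h]; exact Strict.assoc _ _ _),
      (S.isPullback _ _ _).lift_fst _ _ _, (S.isPullback _ _ _).lift_snd _ _ _⟩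
  rw [(comp t t').app_precomp' r (p₁₃ A B C ≫ p₁ A C) (p₁₃ A B C ≫ p₂ A C)
      ((w₁ A B C).trans (w₃ A B C)) _ _ _ (Strict.assoc _ _ _).symm (Strict.assoc _ _ _).symm,
    (comp t t').app_precomp (p₁₃ A B C) _ _ (w A C), Hom.app_self, comp_spec, precomp,
    t.app_precomp' r _ _ (w₁ A B C) _ _ h (Strict.assoc _ _ _).symm rfl,
    t'.app_precomp' r _ _ (w₃ A B C) _ _ h' rfl (Strict.assoc _ _ _).symm]
  simp

/-- The category `K_J(x, y)`, the hom-category from `x` to `y` of the bicategory of fractions: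
its objects are the fractions from `x` to `y`, its arrows are the maps of fractions. -/
noncomputable instance category : Category (Fraction S x y) where
  Hom := Hom
  id := id
  comp := comp
  id_comp {A B} t := by
    apply Hom.ext_of_cover (𝟙 _) (S.id_mem _)
    have h : (𝟙 _ ≫ p₁ A B) ≫ A.left = (𝟙 _ ≫ p₂ A B) ≫ B.left := by
      rw [Strict.assoc, Strict.assoc, w]
    rw [comp_app (id A) t _ _ _ rfl h, id_app, canon_refl]
    simp
  comp_id {A B} t := by
    apply Hom.ext_of_cover (𝟙 _) (S.id_mem _)
    have h : (𝟙 _ ≫ p₁ A B) ≫ A.left = (𝟙 _ ≫ p₂ A B) ≫ B.left := by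
      rw [Strict.assoc, Strict.assoc, w]
    rw [comp_app t (id B) _ _ _ h rfl, id_app, canon_refl]
    simp
  assoc {A B C D} t₁ t₂ t₃ := by
    let f := p₁₃ A B D ≫ p₁ A D ≫ A.left
    let r := S.snd C.left C.mem f
    have hc : (r ≫ pm A B D) ≫ B.left = S.fst C.left C.mem f ≫ C.left := by
      rw [(S.isPullback C.left C.mem f).w, Strict.assoc, ← w₁, Strict.assoc]
    have ha : ((r ≫ p₁₃ A B D) ≫ p₁ A D) ≫ A.left = (r ≫ pm A B D) ≫ B.left := by
      rw [Strict.assoc r (pm A B D), ← w₁]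
      simp only [Strict.assoc]
    have hd : S.fst C.left C.mem f ≫ C.left = ((r ≫ p₁₃ A B D) ≫ p₂ A D) ≫ D.left := by
      rw [← hc, ← ha]
      simp only [Strict.assoc, w]
    apply Hom.ext_of_cover (r ≫ p₁₃ A B D) (S.comp_mem _ _ (S.snd_mem _ _ _) (S.snd_mem _ _ _))
    rw [comp_app (comp t₁ t₂) t₃ _ _ _ (ha.trans hc) hd, comp_app t₁ t₂ _ _ _ ha hc,
      comp_app t₁ (comp t₂ t₃) _ _ _ ha (hc.trans hd), comp_app t₂ t₃ _ _ _ hc hd]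
    exact Category.assoc _ _ _

end

end Fraction

/-- The bicategory of fractions `K_J` is locally essentially small: its objects are the objects of
`K`, and its hom-categories are the categories of fractions and maps of fractions. -/
def FractionsLocallyEssentiallySmall (S : StrictTwoSite K) : Prop :=
  ∀ x y : K, EssentiallySmall.{s} (Fraction S x y)

end TwoSite

/-! A locally small category is essentially small as soon as some map into a small set separates its
isomorphism classes. This criterion is applied to fractions, to zigzags and to the hom-categories of
`L`.

For fractions, WISC gives a cover `p i` factoring through the left leg of any fraction. Restriction
along the factorisation is an isomorphism of fractions (`restrictIso`), so the index `i` and the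
isomorphism class of the restricted right leg determine the fraction up to isomorphism. Maps of
fractions are 2-arrows of `K`, hence form small sets.

For a localisation `Q : K ⥤ᵖ L` no comparison with the bicategory of fractions is made. Instead a
bicategory `ZigzagBicat` is built from `Q`. Its objects are those of `K`, its 1-arrows are formal
composites of arrows of `K` and inverses of weak equivalences, and its 2-arrows are the good
2-arrows of `L` between their realisations, those that come from `K` along all presentations of
source and target. A presentation replaces `Q a ≫ e` by some `Q f`. Every zigzag has one along a
cover (`exists_pres`), since weak equivalences are locally split. Two presentations of one zigzag
differ by a 2-arrow of `K` (`Good.id`), since weak equivalences are fully faithful, and descent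
along covers makes good 2-arrows composable (`Good.comp`). With WISC this makes `ZigzagBicat`
locally essentially small, as for fractions.

Since `K` maps to `ZigzagBicat` and inverts the weak equivalences there, the universal property
gives `G : L ⥤ᵖ ZigzagBicat`. Realisation gives a pseudofunctor back to a copy of `L`. Used again,
the universal property shows that the canonical pseudofunctor from `L` to its copy is a retract of
the composite (`exists_retract`). Hence `G` is faithful on 2-arrows and reflects isomorphism of
1-arrows, and smallness passes to `L`. -/

theorem CategoryTheory.essentiallySmall_of_invariant {C : Type*} [Category* C]
    (hC : ∀ X Y : C, Small.{s} (X ⟶ Y)) {T : Type*} [Small.{s} T] (f : C → T)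
    (hf : ∀ X Y, f X = f Y → Nonempty (X ≅ Y)) : EssentiallySmall.{s} C := by
  rw [essentiallySmall_iff]
  refine ⟨small_of_injective (f := fun X : Skeleton C => f ((fromSkeleton C).obj X)) ?_, ⟨hC⟩⟩
  intro X Y h
  obtain ⟨e⟩ := hf _ _ h
  exact skeleton_skeletal C ⟨(fromSkeleton C).preimageIso e⟩

/-! ### Isomorphisms of fractions and smallness of the categories of fractions. -/

namespace TwoSite

variable {K : Type u} [Bicategory.{w, v} K] [Bicategory.Strict K]

section

attribute [local simp] Strict.associator_eqToIso Strict.leftUnitor_eqToIso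
  Strict.rightUnitor_eqToIso

theorem canon_trans {w u x : K} {j : u ⟶ x} (hj : IsFF j) {a b c : w ⟶ u}
    (h : a ≫ j = b ≫ j) (h' : b ≫ j = c ≫ j) :
    canon hj h ≫ canon hj h' = canon hj (h.trans h') := by
  apply canon_unique
  simp [canon_whisker]

end

namespace Fraction

variable {S : StrictTwoSite K} {x y : K}

/-- The restriction of a fraction along an arrow `z ⟶ u` whose composite with the left leg
`u ⟶ x` is a cover. -/
abbrev restrict (A : Fraction S x y) {z : K} (a : z ⟶ A.obj) (ha : S.J (a ≫ A.left)) :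
    Fraction S x y where
  obj := z
  left := a ≫ A.left
  mem := ha
  right := a ≫ A.right

section

attribute [local simp] Strict.associator_eqToIso Strict.leftUnitor_eqToIso
  Strict.rightUnitor_eqToIso

variable (A : Fraction S x y) {z : K} (a : z ⟶ A.obj) (ha : S.J (a ≫ A.left))

theorem restrict_w₁ {t : K} {c : t ⟶ z} {d : t ⟶ A.obj} (h : c ≫ a ≫ A.left = d ≫ A.left) :
    (c ≫ a) ≫ A.left = d ≫ A.left := by rw [Strict.assoc, h]

/-- The canonical map from a restriction of a fraction. -/
noncomputable def fromRestrict : Hom (A.restrict a ha) A where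
  cell := eqToHom (Strict.assoc _ _ _).symm ≫
    canon (S.ff _ A.mem) (restrict_w₁ A a (w (A.restrict a ha) A)) ▷ A.right

/-- The canonical map to a restriction of a fraction. -/
noncomputable def toRestrict : Hom A (A.restrict a ha) where
  cell := canon (S.ff _ A.mem) (restrict_w₁ A a (w A (A.restrict a ha)).symm).symm ▷ A.right ≫
    eqToHom (Strict.assoc _ _ _)

theorem fromRestrict_app {t : K} (c : t ⟶ z) (d : t ⟶ A.obj) (h : c ≫ a ≫ A.left = d ≫ A.left) :
    (fromRestrict A a ha).app c d h = eqToHom (Strict.assoc _ _ _).symm ≫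
      canon (S.ff _ A.mem) (restrict_w₁ A a h) ▷ A.right := by
  obtain ⟨l, rfl, rfl⟩ : ∃ l : t ⟶ P (A.restrict a ha) A,
      l ≫ p₁ (A.restrict a ha) A = c ∧ l ≫ p₂ (A.restrict a ha) A = d :=
    ⟨_, pair_p₁ (A := A.restrict a ha) c d h, pair_p₂ (A := A.restrict a ha) c d h⟩
  rw [Hom.app_precomp _ l _ _ (w (A.restrict a ha) A), Hom.app_self]
  have e : canon (S.ff _ A.mem) (restrict_w₁ A a h) = eqToHom (Strict.assoc _ _ _) ≫
      l ◁ canon (S.ff _ A.mem) (restrict_w₁ A a (w (A.restrict a ha) A)) := by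
    symm
    apply canon_unique
    simp [canon_whisker]
  rw [e]
  simp [fromRestrict]

theorem toRestrict_app {t : K} (c : t ⟶ z) (d : t ⟶ A.obj) (h : d ≫ A.left = c ≫ a ≫ A.left) :
    (toRestrict A a ha).app d c h = canon (S.ff _ A.mem) (restrict_w₁ A a h.symm).symm ▷ A.right ≫
      eqToHom (Strict.assoc _ _ _) := by
  obtain ⟨l, rfl, rfl⟩ : ∃ l : t ⟶ P A (A.restrict a ha),
      l ≫ p₁ A (A.restrict a ha) = d ∧ l ≫ p₂ A (A.restrict a ha) = c :=
    ⟨_, pair_p₁ (B := A.restrict a ha) d c h, pair_p₂ (B := A.restrict a ha) d c h⟩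
  rw [Hom.app_precomp _ l _ _ (w A (A.restrict a ha)), Hom.app_self]
  have e : canon (S.ff _ A.mem) (restrict_w₁ A a h.symm).symm =
      l ◁ canon (S.ff _ A.mem) (restrict_w₁ A a (w A (A.restrict a ha)).symm).symm ≫
      eqToHom (Strict.assoc _ _ _).symm := by
    symm
    apply canon_unique
    simp [canon_whisker]
  rw [e]
  simp [toRestrict]

/-- The canonical 2-arrow for the left leg `a ≫ A.left`, whiskered with `a`, is the canonical
2-arrow for `A.left`: both become an identity after whiskering with the fully faithful `A.left`.
This identifies a composite computed in `A` with the identity of the restriction. -/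
theorem restrict_canon {t : K} (c d : t ⟶ z) (h : c ≫ a ≫ A.left = d ≫ a ≫ A.left) :
    eqToHom (Strict.assoc _ _ _).symm ≫ canon (S.ff _ A.mem) (a := c ≫ a) (b := d ≫ a)
      (by rw [Strict.assoc, h, Strict.assoc]) ▷ A.right ≫ eqToHom (Strict.assoc _ _ _) =
    canon (S.ff _ ha) h ▷ (a ≫ A.right) := by
  have e : canon (S.ff _ ha) h ▷ a = canon (S.ff _ A.mem) (a := c ≫ a) (b := d ≫ a)
      (by rw [Strict.assoc, h, Strict.assoc]) := by
    apply canon_unique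
    have := canon_whisker (S.ff _ ha) h
    rw [← cancel_epi (α_ _ _ _).inv, ← cancel_mono (α_ _ _ _).hom, Category.assoc,
      ← whiskerRight_comp, this]
    simp
  rw [← e, whiskerRight_comp]
  simp

/-- A fraction is isomorphic to its restrictions. -/
noncomputable def restrictIso : A.restrict a ha ≅ A where
  hom := fromRestrict A a ha
  inv := toRestrict A a ha
  hom_inv_id := by
    let B := A.restrict a ha
    apply Hom.ext_of_cover (𝟙 (P B B)) (S.id_mem _)
    have h : (𝟙 _ ≫ p₁ B B) ≫ B.left = (𝟙 _ ≫ p₂ B B) ≫ B.left := by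
      rw [Strict.assoc, Strict.assoc, w]
    have h₁ : (𝟙 _ ≫ p₁ B B) ≫ B.left = ((𝟙 _ ≫ p₁ B B) ≫ a) ≫ A.left :=
      (Strict.assoc _ _ _).symm
    have := comp_app (fromRestrict A a ha) (toRestrict A a ha) _ _ _ h₁ (h₁.symm.trans h)
    refine this.trans ?_
    refine Eq.trans ?_ (id_app (A := B) _ _ h).symm
    refine Eq.trans ?_ (restrict_canon A a ha _ _ h)
    rw [fromRestrict_app, toRestrict_app, canon_refl, id_whiskerRight, Category.comp_id]
  inv_hom_id := by
    let B := A.restrict a ha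
    -- The middle fraction is now the restriction, and a component in its vertex `z` need not exist
    -- on `P A A`; the triple pullback supplies one.
    apply Hom.ext_of_cover (p₁₃ A B A) (S.snd_mem _ _ _)
    have := comp_app (toRestrict A a ha) (fromRestrict A a ha) _ _ _ (w₁ A B A) (w₃ A B A)
    refine this.trans ?_
    refine Eq.trans ?_ (id_app (A := A) _ _ ((w₁ A B A).trans (w₃ A B A))).symm
    rw [fromRestrict_app, toRestrict_app]
    simp only [Category.assoc, eqToHom_trans_assoc, eqToHom_refl, Category.id_comp]
    rw [← comp_whiskerRight, canon_trans]

variable {p : z ⟶ x} (hp : S.J p) {f g : z ⟶ y}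

/-- The map of fractions with equal left legs induced by a 2-arrow of right legs. -/
noncomputable def ofRight (e : f ⟶ g) :
    Hom (⟨z, p, hp, f⟩ : Fraction S x y) ⟨z, p, hp, g⟩ where
  cell := canon (S.ff _ hp) (w ⟨z, p, hp, f⟩ ⟨z, p, hp, g⟩) ▷ f ≫ p₂ _ _ ◁ e

theorem ofRight_app (e : f ⟶ g) {t : K} (c d : t ⟶ z) (h : c ≫ p = d ≫ p) :
    (ofRight hp e).app c d h = canon (S.ff _ hp) h ▷ f ≫ d ◁ e := by
  let A : Fraction S x y := ⟨z, p, hp, f⟩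
  let B : Fraction S x y := ⟨z, p, hp, g⟩
  obtain ⟨l, rfl, rfl⟩ : ∃ l : t ⟶ P A B, l ≫ p₁ A B = c ∧ l ≫ p₂ A B = d :=
    ⟨_, pair_p₁ (A := A) (B := B) c d h, pair_p₂ (A := A) (B := B) c d h⟩
  rw [Hom.app_precomp _ l _ _ (w A B), Hom.app_self, ← canon_precomp _ (w A B)]
  simp [ofRight, A, B]

theorem ofRight_comp (e : f ≅ g) :
    comp (ofRight hp e.hom) (ofRight hp e.inv) = id ⟨z, p, hp, f⟩ := by
  let A : Fraction S x y := ⟨z, p, hp, f⟩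
  apply Hom.ext_of_cover (𝟙 (P A A)) (S.id_mem _)
  have h : (𝟙 _ ≫ p₁ A A) ≫ A.left = (𝟙 _ ≫ p₂ A A) ≫ A.left := by
    rw [Strict.assoc, Strict.assoc, w]
  refine (comp_app (ofRight hp e.hom) (ofRight hp e.inv) _ (𝟙 _ ≫ p₁ A A) _ rfl h).trans ?_
  refine Eq.trans ?_ (id_app (A := A) _ _ h).symm
  rw [ofRight_app, ofRight_app, canon_refl, id_whiskerRight, Category.id_comp (_ ◁ e.hom),
    whisker_exchange_assoc, ← whiskerLeft_comp, e.hom_inv_id, whiskerLeft_id, Category.comp_id (_ ▷ _)]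

/-- Fractions with the same left leg and isomorphic right legs are isomorphic. -/
noncomputable def isoOfRightIso (e : f ≅ g) :
    (⟨z, p, hp, f⟩ : Fraction S x y) ≅ ⟨z, p, hp, g⟩ where
  hom := ofRight hp e.hom
  inv := ofRight hp e.inv
  hom_inv_id := ofRight_comp hp e
  inv_hom_id := ofRight_comp hp e.symm

end

/-- The separating invariant of a fraction is the index of a weakly initial cover refining its left
leg, with the isomorphism class of the refined right leg. -/
theorem essentiallySmall (hK : LocallyEssentiallySmall.{s} K) (hW : WISC.{s} S) (x y : K) :
    EssentiallySmall.{s} (Fraction S x y) := by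
  have := fun z : K => hK z y
  obtain ⟨I, c, p, hp, H⟩ := hW x
  choose i a ha using fun A : Fraction S x y => H A.obj A.left A.mem
  refine essentiallySmall_of_invariant (T := Σ i, Skeleton (c i ⟶ y)) (fun A B => ?_)
    (fun A => ⟨i A, toSkeleton (a A ≫ A.right)⟩) ?_
  · exact small_of_injective (f := fun t : Hom A B => t.cell) fun _ _ h => Hom.ext h
  · intro A B h
    have key : ∀ A : Fraction S x y, Nonempty (A ≅ ⟨c (i A), p (i A), hp _, a A ≫ A.right⟩) := by
      intro A
      have h : S.J (a A ≫ A.left) := by rw [ha]; exact hp _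
      have e : A.restrict (a A) h = ⟨c (i A), p (i A), hp _, a A ≫ A.right⟩ := by
        simp only [restrict, ha]
      exact ⟨(restrictIso A (a A) h).symm ≪≫ eqToIso e⟩
    obtain ⟨eA⟩ := key A
    obtain ⟨eB⟩ := key B
    -- Stated for free indices, so that the equality of indices can be eliminated by substitution.
    have key₂ : ∀ (i j : I) (f : c i ⟶ y) (g : c j ⟶ y),
        (⟨i, toSkeleton f⟩ : Σ i, Skeleton (c i ⟶ y)) = ⟨j, toSkeleton g⟩ →
        Nonempty ((⟨c i, p i, hp _, f⟩ : Fraction S x y) ≅ ⟨c j, p j, hp _, g⟩) := by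
      intro i j f g h
      obtain rfl : i = j := congrArg Sigma.fst h
      have : toSkeleton f = toSkeleton g := by simpa using h
      obtain ⟨e⟩ := toSkeleton_eq_toSkeleton_iff.1 this
      exact ⟨isoOfRightIso _ e⟩
    obtain ⟨e⟩ := key₂ _ _ _ _ h
    exact ⟨eA ≪≫ e ≪≫ eB.symm⟩

end Fraction

end TwoSite

/-! ### Equivalences in a bicategory; zigzags and their presentations. -/

namespace TwoSite

section Equivalences

variable {L : Type u'} [Bicategory.{w', v'} L] {x y : L} {f : x ⟶ y}

theorem IsEquiv.isEquivalence_precomp (hf : IsEquiv f) (z : L) :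
    (precomp z f).IsEquivalence := by
  obtain ⟨g, ⟨e⟩, ⟨e'⟩⟩ := hf
  exact (CategoryTheory.Equivalence.mk (precomp z f) (precomp z g)
    (NatIso.ofComponents (fun h => (λ_ h).symm ≪≫ whiskerRightIso e'.symm h ≪≫ α_ _ _ _)
      (fun {h h'} k => by
        change k ≫ (λ_ h').inv ≫ e'.inv ▷ h' ≫ (α_ g f h').hom =
          ((λ_ h).inv ≫ e'.inv ▷ h ≫ (α_ g f h).hom) ≫ g ◁ f ◁ k
        rw [leftUnitor_inv_naturality_assoc, whisker_exchange_assoc, Category.assoc,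
          Category.assoc, associator_naturality_right]))
    (NatIso.ofComponents (fun h => (α_ _ _ _).symm ≪≫ whiskerRightIso e h ≪≫ λ_ h)
      (fun {h h'} k => by
        change f ◁ g ◁ k ≫ (α_ f g h').inv ≫ e.hom ▷ h' ≫ (λ_ h').hom =
          ((α_ f g h).inv ≫ e.hom ▷ h ≫ (λ_ h).hom) ≫ k
        rw [associator_inv_naturality_right_assoc, whisker_exchange_assoc, Category.assoc,
          Category.assoc, leftUnitor_naturality]))).isEquivalence_functor

/-- Precomposition with an equivalence is fully faithful. For the image under `Q` of a cover, this
allows 2-arrows of `L` to be compared and constructed over the cover. -/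
theorem IsEquiv.whiskerLeft_bijective (hf : IsEquiv f) {z : L} (g h : y ⟶ z) :
    Function.Bijective (fun a : g ⟶ h => f ◁ a) := by
  have := hf.isEquivalence_precomp z
  exact ⟨(precomp z f).map_injective, (precomp z f).map_surjective⟩

theorem IsEquiv.whiskerLeft_cancel (hf : IsEquiv f) {z : L} {g h : y ⟶ z} {a b : g ⟶ h}
    (e : f ◁ a = f ◁ b) : a = b :=
  (hf.whiskerLeft_bijective g h).1 e

/-- A chosen pseudo-inverse. -/
noncomputable def IsEquiv.inv (hf : IsEquiv f) : y ⟶ x := hf.choose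

/-- The unit of the chosen pseudo-inverse. -/
noncomputable def IsEquiv.unit (hf : IsEquiv f) : 𝟙 x ≅ f ≫ hf.inv :=
  hf.choose_spec.1.some.symm

/-- The counit of the chosen pseudo-inverse, which satisfies the triangle identities with the
unit. -/
noncomputable def IsEquiv.counit (hf : IsEquiv f) : hf.inv ≫ f ≅ 𝟙 y :=
  adjointifyCounit hf.unit hf.choose_spec.2.some

theorem IsEquiv.triangle (hf : IsEquiv f) :
    hf.unit.hom ▷ f ≫ (α_ _ _ _).hom ≫ f ◁ hf.counit.hom = (λ_ f).hom ≫ (ρ_ f).inv := by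
  have := congrArg Iso.hom (adjointifyCounit_left_triangle hf.unit hf.choose_spec.2.some)
  simpa [leftZigzagIso, bicategoricalIsoComp, IsEquiv.counit] using this

theorem IsEquiv.triangle_inv (hf : IsEquiv f) :
    hf.unit.inv ▷ f ≫ (λ_ f).hom = (α_ _ _ _).hom ≫ f ◁ hf.counit.hom ≫ (ρ_ f).hom := by
  have := hf.triangle
  rw [← cancel_epi (hf.unit.hom ▷ f), ← comp_whiskerRight_assoc, Iso.hom_inv_id, id_whiskerRight,
    Category.id_comp]
  simp only [← Category.assoc] at this ⊢
  rw [this]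
  simp

end Equivalences

variable {K : Type u} [Bicategory.{w, v} K] [Bicategory.Strict K] (S : StrictTwoSite K)

theorem StrictTwoSite.weakEquivalences_of_mem {u x : K} {j : u ⟶ x} (hj : S.J j) :
    weakEquivalences S j :=
  ⟨S.ff j hj, u, j, 𝟙 u, hj, ⟨λ_ j⟩⟩

/-- Formal composites of arrows of `K` and formal inverses of weak equivalences. -/
inductive Zigzag : K → K → Type (max u v)
  | id (x : K) : Zigzag x x
  | of {x y : K} (f : x ⟶ y) : Zigzag x y
  | inv {x y : K} (q : x ⟶ y) (hq : weakEquivalences S q) : Zigzag y x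
  | comp {x y z : K} (e : Zigzag x y) (e' : Zigzag y z) : Zigzag x z

variable {S} {L : Type u'} [Bicategory.{w', v'} L] {Q : K ⥤ᵖ L}
  (hQ : Inverts (weakEquivalences S) Q)

namespace Zigzag

/-- The composite in `L` of a zigzag in `K`. -/
noncomputable def real : ∀ {x y : K}, Zigzag S x y → (Q.obj x ⟶ Q.obj y)
  | _, _, id x => 𝟙 (Q.obj x)
  | _, _, of f => Q.map f
  | _, _, inv q hq => (hQ q hq).inv
  | _, _, comp e e' => real e ≫ real e'

/-- `Pres hQ e a f χ` expresses that the 2-arrow `χ : Q a ≫ e ⟶ Q f` is a composite of constraints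
of `Q`, units of the chosen inverses, and images of invertible 2-arrows of `K`. -/
def Pres : ∀ {x y : K} (e : Zigzag S x y) {z : K} (a : z ⟶ x) (f : z ⟶ y),
    (Q.map a ≫ real hQ e ⟶ Q.map f) → Prop
  | _, _, id _, _, a, f, χ => ∃ θ : a ≅ f, χ = (ρ_ _).hom ≫ Q.map₂ θ.hom
  | _, _, of g, _, a, f, χ => ∃ θ : a ≫ g ≅ f, χ = (Q.mapComp a g).inv ≫ Q.map₂ θ.hom
  | _, _, inv q hq, _, a, f, χ => ∃ θ : f ≫ q ≅ a,
      χ = (Q.map₂ θ.inv ≫ (Q.mapComp f q).hom) ▷ (hQ q hq).inv ≫ (α_ _ _ _).hom ≫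
        Q.map f ◁ (hQ q hq).unit.inv ≫ (ρ_ _).hom
  | _, _, comp e e', _, a, f, χ => ∃ f' χ₁ χ₂, Pres e a f' χ₁ ∧ Pres e' f' f χ₂ ∧
      χ = (α_ _ _ _).inv ≫ χ₁ ▷ real hQ e' ≫ χ₂

variable {hQ}

theorem Pres.isIso {x y z : K} {e : Zigzag S x y} {a : z ⟶ x} {f : z ⟶ y}
    {χ : Q.map a ≫ real hQ e ⟶ Q.map f} (h : Pres hQ e a f χ) : IsIso χ := by
  induction e with
  | id x =>
    obtain ⟨θ, rfl⟩ := h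
    exact inferInstanceAs (IsIso ((ρ_ (Q.map _)).hom ≫ Q.map₂ θ.hom))
  | of g =>
    obtain ⟨θ, rfl⟩ := h
    exact inferInstanceAs (IsIso ((Q.mapComp _ g).inv ≫ Q.map₂ θ.hom))
  | inv q hq =>
    obtain ⟨θ, rfl⟩ := h
    exact inferInstanceAs (IsIso ((Q.map₂ θ.inv ≫ (Q.mapComp f q).hom) ▷ (hQ q hq).inv ≫
      (α_ _ _ _).hom ≫ Q.map f ◁ (hQ q hq).unit.inv ≫ (ρ_ _).hom))
  | comp e e' ih ih' =>
    obtain ⟨f', χ₁, χ₂, h₁, h₂, rfl⟩ := h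
    have := ih h₁
    have := ih' h₂
    exact inferInstanceAs (IsIso ((α_ _ _ _).inv ≫ χ₁ ▷ real hQ e' ≫ χ₂))

/-- The restriction of a 2-arrow `Q a ≫ h ⟶ Q f` along an arrow of `K`. -/
def pull {x y z z' : K} (q : z' ⟶ z) {h : Q.obj x ⟶ Q.obj y} {a : z ⟶ x} {f : z ⟶ y}
    (χ : Q.map a ≫ h ⟶ Q.map f) : Q.map (q ≫ a) ≫ h ⟶ Q.map (q ≫ f) :=
  (Q.mapComp q a).hom ▷ h ≫ (α_ _ _ _).hom ≫ Q.map q ◁ χ ≫ (Q.mapComp q f).inv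

/-- Each ingredient of a presentation is compatible with precomposition by an arrow of `K`, so the
isomorphisms `θ` are simply whiskered with `q`, up to associators. -/
theorem Pres.pull {x y z z' : K} (q : z' ⟶ z) {e : Zigzag S x y} {a : z ⟶ x} {f : z ⟶ y}
    {χ : Q.map a ≫ real hQ e ⟶ Q.map f} (h : Pres hQ e a f χ) :
    Pres hQ e (q ≫ a) (q ≫ f) (Zigzag.pull q χ) := by
  induction e with
  | id x =>
    obtain ⟨θ, rfl⟩ := h
    refine ⟨whiskerLeftIso q θ, ?_⟩
    simp [Zigzag.pull, real]
  | of g =>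
    obtain ⟨θ, rfl⟩ := h
    refine ⟨α_ _ _ _ ≪≫ whiskerLeftIso q θ, ?_⟩
    simp [Zigzag.pull, real]
  | inv j hj =>
    obtain ⟨θ, rfl⟩ := h
    refine ⟨α_ _ _ _ ≪≫ whiskerLeftIso q θ, ?_⟩
    have h : (Q.mapComp q (f ≫ j)).inv ≫ Q.map₂ (α_ q f j).inv ≫ (Q.mapComp (q ≫ f) j).hom =
        Q.map q ◁ (Q.mapComp f j).hom ≫ (α_ _ _ _).inv ≫ (Q.mapComp q f).inv ▷ Q.map j := by
      rw [Iso.inv_comp_eq, Q.mapComp_assoc_right_hom_assoc]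
      simp
    simp only [Zigzag.pull, real, Iso.trans_inv, whiskerLeftIso_inv, Q.map₂_comp, Category.assoc,
      Q.map₂_whisker_left]
    rw [h]
    simp only [comp_whiskerRight, whiskerLeft_comp, Category.assoc, associator_naturality_left_assoc,
      ← whisker_exchange_assoc, rightUnitor_naturality]
    simp
  | comp e e' ih ih' =>
    obtain ⟨f', χ₁, χ₂, h₁, h₂, rfl⟩ := h
    refine ⟨_, _, _, ih h₁, ih' h₂, ?_⟩
    simp [Zigzag.pull, real]

end Zigzag

end TwoSite

/-! ### Good 2-arrows: locality and closure properties. -/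

namespace TwoSite

variable {K : Type u} [Bicategory.{w, v} K] [Bicategory.Strict K] {S : StrictTwoSite K}
  {L : Type u'} [Bicategory.{w', v'} L] {Q : K ⥤ᵖ L} {hQ : Inverts (weakEquivalences S) Q}

namespace Zigzag

variable (hQ) in
/-- A 2-arrow of `L` between zigzags is good if it comes from `K` along all presentations of the
two zigzags. -/
def Good {x y : K} (e e' : Zigzag S x y) (α : real hQ e ⟶ real hQ e') : Prop :=
  ∀ ⦃z : K⦄ ⦃a a' : z ⟶ x⦄ (b : a ⟶ a') ⦃f f' : z ⟶ y⦄
    ⦃χ : Q.map a ≫ real hQ e ⟶ Q.map f⦄ ⦃χ' : Q.map a' ≫ real hQ e' ⟶ Q.map f'⦄,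
    Pres hQ e a f χ → Pres hQ e' a' f' χ' →
    ∃ b' : f ⟶ f', χ ≫ Q.map₂ b' = Q.map₂ b ▷ real hQ e ≫ Q.map a' ◁ α ≫ χ'

theorem pull_comp_map₂ {x y z z' : K} (q : z' ⟶ z) {h : Q.obj x ⟶ Q.obj y} {a : z ⟶ x}
    {f f' : z ⟶ y} (χ : Q.map a ≫ h ⟶ Q.map f) (b : f ⟶ f') :
    pull q χ ≫ Q.map₂ (q ◁ b) = pull q (χ ≫ Q.map₂ b) := by
  simp [pull]

theorem pull_whiskerRight {x y z z' : K} (q : z' ⟶ z) {h : Q.obj x ⟶ Q.obj y} {a a' : z ⟶ x}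
    {f : z ⟶ y} (χ : Q.map a' ≫ h ⟶ Q.map f) (b : a ⟶ a') :
    pull q (Q.map₂ b ▷ h ≫ χ) = Q.map₂ (q ◁ b) ▷ h ≫ pull q χ := by
  simp [pull]

theorem pull_whiskerLeft {x y z z' : K} (q : z' ⟶ z) {h h' : Q.obj x ⟶ Q.obj y} {a : z ⟶ x}
    {f : z ⟶ y} (χ : Q.map a ≫ h' ⟶ Q.map f) (α : h ⟶ h') :
    pull q (Q.map a ◁ α ≫ χ) = Q.map (q ≫ a) ◁ α ≫ pull q χ := by
  simp [pull, whisker_exchange_assoc]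

theorem pull_injective {x y z z' : K} (hQ : Inverts (weakEquivalences S) Q)
    {q : z' ⟶ z} (hq : S.J q) {h : Q.obj x ⟶ Q.obj y}
    {a : z ⟶ x} {f : z ⟶ y} {χ χ' : Q.map a ≫ h ⟶ Q.map f} (e : pull q χ = pull q χ') :
    χ = χ' := by
  simp only [pull, cancel_epi, cancel_mono] at e
  exact (hQ q (S.weakEquivalences_of_mem hq)).whiskerLeft_cancel e

/-- Goodness is local: the witness descends along the cover `q` in `K`, and the equation in `L` may
be tested over `q` because `Q q` is an equivalence. -/
theorem exists_of_cover (hQ : Inverts (weakEquivalences S) Q) {x y z z' : K} {q : z' ⟶ z} (hq : S.J q) {h h' : Q.obj x ⟶ Q.obj y}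
    {α : h ⟶ h'} {a a' : z ⟶ x} {b : a ⟶ a'} {f f' : z ⟶ y} {χ : Q.map a ≫ h ⟶ Q.map f}
    {χ' : Q.map a' ≫ h' ⟶ Q.map f'} (b' : q ≫ f ⟶ q ≫ f')
    (e : pull q χ ≫ Q.map₂ b' = Q.map₂ (q ◁ b) ▷ h ≫ Q.map (q ≫ a') ◁ α ≫ pull q χ') :
    ∃ b' : f ⟶ f', χ ≫ Q.map₂ b' = Q.map₂ b ▷ h ≫ Q.map a' ◁ α ≫ χ' := by
  obtain ⟨b', rfl, -⟩ := descent S hq b'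
  refine ⟨b', pull_injective hQ hq ?_⟩
  rw [← pull_comp_map₂, e, pull_whiskerRight, pull_whiskerLeft]

variable (hQ) in
theorem exists_pres {x y : K} (e : Zigzag S x y) :
    ∃ (z : K) (c : z ⟶ x) (f : z ⟶ y) (χ : Q.map c ≫ real hQ e ⟶ Q.map f),
      S.J c ∧ Pres hQ e c f χ := by
  induction e with
  | id x => exact ⟨x, 𝟙 x, _, _, S.id_mem x, Iso.refl _, rfl⟩
  | of g => exact ⟨_, 𝟙 _, _, _, S.id_mem _, Iso.refl _, rfl⟩
  | inv q hq =>
    -- A local splitting of `q` is a presentation of its formal inverse along a cover.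
    obtain ⟨u, j, r, hj, ⟨θ⟩⟩ := hq.2
    exact ⟨_, j, r, _, hj, θ, rfl⟩
  | comp e e' ih ih' =>
    obtain ⟨z, c, f, χ, hc, h⟩ := ih
    obtain ⟨z', c', f', χ', hc', h'⟩ := ih'
    -- The cover presenting the second factor is pulled back along `f`. The type of `χ''` depends on
    -- the 1-arrow, so the pullback square is rewritten under the existential quantifier.
    have H : ∃ g χ'', Pres hQ e' (S.fst c' hc' f ≫ c') g χ'' := ⟨_, _, h'.pull _⟩
    rw [(S.isPullback c' hc' f).w] at H
    obtain ⟨g, χ'', h''⟩ := H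
    exact ⟨_, _, g, _, S.comp_mem _ _ (S.snd_mem c' hc' f) hc, _, _, _, h.pull _, h'', rfl⟩

variable (hQ) in
theorem exists_pres_over {x y z : K} (e : Zigzag S x y) (a : z ⟶ x) :
    ∃ (z' : K) (q : z' ⟶ z) (f : z' ⟶ y) (χ : Q.map (q ≫ a) ≫ real hQ e ⟶ Q.map f),
      S.J q ∧ Pres hQ e (q ≫ a) f χ := by
  obtain ⟨u, c, f, χ, hc, h⟩ := exists_pres hQ e
  have H : ∃ g χ', Pres hQ e (S.fst c hc a ≫ c) g χ' := ⟨_, _, h.pull _⟩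
  rw [(S.isPullback c hc a).w] at H
  obtain ⟨g, χ', h'⟩ := H
  exact ⟨_, _, g, χ', S.snd_mem c hc a, h'⟩

/-- Presentations of one zigzag along `a` and `a'` are compared by a 2-arrow of `K` over any `b : a
⟶ a'`. For a formal inverse this needs full faithfulness of `q`. For a composite, the comparison of
the first factors serves as `b` for the second, which is why `Good` allows an arbitrary `b`. -/
theorem Good.id {x y : K} (e : Zigzag S x y) : Good hQ e e (𝟙 _) := by
  induction e with
  | id x =>
    rintro z a a' b f f' χ χ' ⟨θ, rfl⟩ ⟨θ', rfl⟩
    refine ⟨θ.inv ≫ b ≫ θ'.hom, ?_⟩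
    have h : Q.map₂ θ.hom ≫ Q.map₂ (θ.inv ≫ b ≫ θ'.hom) = Q.map₂ b ≫ Q.map₂ θ'.hom := by
      rw [← Q.map₂_comp, ← Q.map₂_comp, Iso.hom_inv_id_assoc]
    simp only [real, Category.assoc, h]
    simp
  | of g =>
    rintro z a a' b f f' χ χ' ⟨θ, rfl⟩ ⟨θ', rfl⟩
    refine ⟨θ.inv ≫ b ▷ g ≫ θ'.hom, ?_⟩
    have h : Q.map₂ θ.hom ≫ Q.map₂ (θ.inv ≫ b ▷ g ≫ θ'.hom) = Q.map₂ (b ▷ g) ≫ Q.map₂ θ'.hom := by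
      rw [← Q.map₂_comp, ← Q.map₂_comp, Iso.hom_inv_id_assoc]
    simp only [real, Category.assoc, h]
    simp
  | inv q hq =>
    rintro z a a' b f f' χ χ' ⟨θ, rfl⟩ ⟨θ', rfl⟩
    -- Here `f` and `f'` are lifts of `a` and `a'` through `q`, so `b` lifts as well.
    obtain ⟨b', hb⟩ := (hq.1 f f').2 (θ.hom ≫ b ≫ θ'.inv)
    refine ⟨b', ?_⟩
    have h : (Q.map₂ θ.inv ≫ (Q.mapComp f q).hom) ≫ Q.map₂ b' ▷ Q.map q =
        Q.map₂ b ≫ Q.map₂ θ'.inv ≫ (Q.mapComp f' q).hom := by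
      have e : b' ▷ q = _ := hb
      rw [← cancel_mono (Q.mapComp f' q).inv]
      simp only [Category.assoc]
      rw [← Q.map₂_whisker_right, e, Iso.hom_inv_id, Category.comp_id]
      simp only [← Q.map₂_comp, Iso.inv_hom_id_assoc]
    simp only [real, whiskerLeft_id, Category.id_comp, Category.assoc]
    rw [← rightUnitor_naturality, whisker_exchange_assoc, ← associator_naturality_left_assoc,
      ← comp_whiskerRight_assoc, h]
    simp
  | comp e e' ih ih' =>
    rintro z a a' b f f' χ χ' ⟨g, χ₁, χ₂, h₁, h₂, rfl⟩ ⟨g', χ₁', χ₂', h₁', h₂', rfl⟩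
    obtain ⟨b₁, e₁⟩ := ih b h₁ h₁'
    obtain ⟨b₂, e₂⟩ := ih' b₁ h₂ h₂'
    refine ⟨b₂, ?_⟩
    simp only [whiskerLeft_id, Category.id_comp] at e₁ e₂
    simp only [real, Category.assoc, e₂]
    rw [← comp_whiskerRight_assoc, e₁]
    simp

/-- The middle zigzag is presented only over a cover of `z`. The two witnesses are composed there
and the result descends. -/
theorem Good.comp {x y : K} {e e' e'' : Zigzag S x y} {α : real hQ e ⟶ real hQ e'}
    {α' : real hQ e' ⟶ real hQ e''} (h : Good hQ e e' α) (h' : Good hQ e' e'' α') :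
    Good hQ e e'' (α ≫ α') := by
  intro z a a' b f f' χ χ' p p'
  obtain ⟨z', q, g, ψ, hq, pq⟩ := exists_pres_over hQ e' a'
  obtain ⟨b₁, e₁⟩ := h (q ◁ b) (p.pull q) pq
  obtain ⟨b₂, e₂⟩ := h' (𝟙 _) pq (p'.pull q)
  refine exists_of_cover hQ hq (b := b) (b₁ ≫ b₂) ?_
  simp only [Q.map₂_id, id_whiskerRight, Category.id_comp] at e₂
  rw [Q.map₂_comp, reassoc_of% e₁, e₂]
  simp

/-- One pair of presentations over a cover suffices: over the pullback of the cover, arbitrary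
presentations are compared with the given ones by `Good.id` on both sides. -/
theorem good_of_pres {x y z : K} {c : z ⟶ x} (hc : S.J c) {e e' : Zigzag S x y}
    {f f' : z ⟶ y} {χ : Q.map c ≫ real hQ e ⟶ Q.map f} {χ' : Q.map c ≫ real hQ e' ⟶ Q.map f'}
    (p : Pres hQ e c f χ) (p' : Pres hQ e' c f' χ') {α : real hQ e ⟶ real hQ e'} (b : f ⟶ f')
    (h : χ ≫ Q.map₂ b = Q.map c ◁ α ≫ χ') : Good hQ e e' α := by
  intro t a a' b₀ g g' ψ ψ' r r'
  let q := S.snd c hc a'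
  have hq : S.J q := S.snd_mem c hc a'
  have H : ∃ (f₂ f₂' : _ ⟶ y) (χ₂ : Q.map (S.fst c hc a' ≫ c) ≫ real hQ e ⟶ Q.map f₂)
      (χ₂' : Q.map (S.fst c hc a' ≫ c) ≫ real hQ e' ⟶ Q.map f₂') (b₂ : f₂ ⟶ f₂'),
      Pres hQ e _ f₂ χ₂ ∧ Pres hQ e' _ f₂' χ₂' ∧ χ₂ ≫ Q.map₂ b₂ = Q.map _ ◁ α ≫ χ₂' :=
    ⟨_, _, _, _, _ ◁ b, p.pull _, p'.pull _, by rw [pull_comp_map₂, h, pull_whiskerLeft]⟩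
  rw [(S.isPullback c hc a').w] at H
  obtain ⟨f₂, f₂', χ₂, χ₂', b₂, p₂, p₂', h₂⟩ := H
  -- The first comparison absorbs `b₀`; the second then lies over an identity.
  obtain ⟨b₁, e₁⟩ := Good.id e (q ◁ b₀) (r.pull q) p₂
  obtain ⟨b₃, e₃⟩ := Good.id e' (𝟙 _) p₂' (r'.pull q)
  refine exists_of_cover hQ hq (b := b₀) (b₁ ≫ b₂ ≫ b₃) ?_
  simp only [Q.map₂_id, id_whiskerRight, whiskerLeft_id, Category.id_comp] at e₁ e₃
  rw [Q.map₂_comp, Q.map₂_comp, reassoc_of% e₁, reassoc_of% h₂, e₃]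

theorem Good.whiskerLeft {x y z : K} (e : Zigzag S x y) {k k' : Zigzag S y z}
    {α : real hQ k ⟶ real hQ k'} (h : Good hQ k k' α) :
    Good hQ (e.comp k) (e.comp k') (real hQ e ◁ α) := by
  rintro t a a' b f f' χ χ' ⟨g, χ₁, χ₂, h₁, h₂, rfl⟩ ⟨g', χ₁', χ₂', h₁', h₂', rfl⟩
  obtain ⟨b₁, e₁⟩ := Good.id e b h₁ h₁'
  obtain ⟨b₂, e₂⟩ := h b₁ h₂ h₂'
  refine ⟨b₂, ?_⟩
  simp only [whiskerLeft_id, Category.id_comp] at e₁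
  simp only [real, Category.assoc, e₂]
  rw [← comp_whiskerRight_assoc, e₁, comp_whiskerRight, Category.assoc, ← whisker_exchange_assoc]
  simp

theorem Good.whiskerRight {x y z : K} {e e' : Zigzag S x y} (k : Zigzag S y z)
    {α : real hQ e ⟶ real hQ e'} (h : Good hQ e e' α) :
    Good hQ (e.comp k) (e'.comp k) (α ▷ real hQ k) := by
  rintro t a a' b f f' χ χ' ⟨g, χ₁, χ₂, h₁, h₂, rfl⟩ ⟨g', χ₁', χ₂', h₁', h₂', rfl⟩
  obtain ⟨b₁, e₁⟩ := h b h₁ h₁'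
  obtain ⟨b₂, e₂⟩ := Good.id k b₁ h₂ h₂'
  refine ⟨b₂, ?_⟩
  simp only [whiskerLeft_id, Category.id_comp] at e₂
  simp only [real, Category.assoc, e₂]
  rw [← comp_whiskerRight_assoc, e₁]
  simp

end Zigzag

end TwoSite

/-! ### Goodness of the structural 2-arrows of the zigzag bicategory. -/

namespace TwoSite

variable {K : Type u} [Bicategory.{w, v} K] [Bicategory.Strict K] {S : StrictTwoSite K}
  {L : Type u'} [Bicategory.{w', v'} L] {Q : K ⥤ᵖ L} (hQ : Inverts (weakEquivalences S) Q)

/-- By the triangle identity, the presentation of a formal inverse built from `φ`, whiskered with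
`f`, collapses to `φ` up to the counit. It serves to prove the counit good, and is the reason for
choosing the counit adjoint to the unit. -/
theorem IsEquiv.whiskerRight_comp_counit {x y z : L} {f : x ⟶ y} (hf : IsEquiv f) {p : z ⟶ y}
    {g : z ⟶ x} (φ : p ⟶ g ≫ f) :
    (α_ _ _ _).inv ≫ (φ ▷ hf.inv ≫ (α_ _ _ _).hom ≫ g ◁ hf.unit.inv ≫ (ρ_ _).hom) ▷ f =
      p ◁ hf.counit.hom ≫ (ρ_ _).hom ≫ φ := by
  have h : (α_ g f hf.inv).hom ▷ f ≫ (g ◁ hf.unit.inv) ▷ f ≫ (ρ_ g).hom ▷ f =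
      (α_ (g ≫ f) hf.inv f).hom ≫ (g ≫ f) ◁ hf.counit.hom ≫ (ρ_ (g ≫ f)).hom := by
    calc
      _ = (α_ (g ≫ f) hf.inv f).hom ≫ (α_ g f (hf.inv ≫ f)).hom ≫ g ◁ (α_ f hf.inv f).inv ≫
          g ◁ (hf.unit.inv ▷ f ≫ (λ_ f).hom) := by bicategory
      _ = _ := by
        rw [hf.triangle_inv]
        simp
  simp only [comp_whiskerRight, h]
  rw [associator_naturality_left_assoc, Iso.inv_hom_id_assoc, ← whisker_exchange_assoc,
    rightUnitor_naturality]

namespace Zigzag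

/-- Both bracketings are presented by presentations of the same three zigzags, so three comparisons
by `Good.id`, each lying over the previous one, give the witness. -/
theorem good_associator_hom {x y z t : K} (e : Zigzag S x y) (k : Zigzag S y z)
    (l : Zigzag S z t) : Good hQ ((e.comp k).comp l) (e.comp (k.comp l))
      (α_ (real hQ e) (real hQ k) (real hQ l)).hom := by
  rintro s a a' b f f' χ χ' ⟨g, _, χ₃, ⟨h, χ₁, χ₂, p₁, p₂, rfl⟩, p₃, rfl⟩
    ⟨h', χ₁', _, p₁', ⟨g', χ₂', χ₃', p₂', p₃', rfl⟩, rfl⟩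
  obtain ⟨b₁, e₁⟩ := Good.id e b p₁ p₁'
  obtain ⟨b₂, e₂⟩ := Good.id k b₁ p₂ p₂'
  obtain ⟨b₃, e₃⟩ := Good.id l b₂ p₃ p₃'
  refine ⟨b₃, ?_⟩
  simp only [whiskerLeft_id, Category.id_comp] at e₁ e₂ e₃
  simp only [real, Category.assoc, e₃, comp_whiskerRight]
  rw [← comp_whiskerRight_assoc χ₂, e₂, comp_whiskerRight, Category.assoc,
    ← comp_whiskerRight_assoc (χ₁ ▷ _), ← comp_whiskerRight, e₁]
  simp

theorem good_associator_inv {x y z t : K} (e : Zigzag S x y) (k : Zigzag S y z)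
    (l : Zigzag S z t) : Good hQ (e.comp (k.comp l)) ((e.comp k).comp l)
      (α_ (real hQ e) (real hQ k) (real hQ l)).inv := by
  rintro s a a' b f f' χ χ' ⟨h, χ₁, _, p₁, ⟨g, χ₂, χ₃, p₂, p₃, rfl⟩, rfl⟩
    ⟨g', _, χ₃', ⟨h', χ₁', χ₂', p₁', p₂', rfl⟩, p₃', rfl⟩
  obtain ⟨b₁, e₁⟩ := Good.id e b p₁ p₁'
  obtain ⟨b₂, e₂⟩ := Good.id k b₁ p₂ p₂'
  obtain ⟨b₃, e₃⟩ := Good.id l b₂ p₃ p₃'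
  refine ⟨b₃, ?_⟩
  simp only [whiskerLeft_id, Category.id_comp] at e₁ e₂ e₃
  simp only [real, Category.assoc, e₃]
  rw [← comp_whiskerRight_assoc χ₂, e₂, comp_whiskerRight, Category.assoc,
    ← associator_inv_naturality_left_assoc, ← comp_whiskerRight_assoc χ₁, e₁]
  simp

theorem good_leftUnitor_hom {x y : K} (e : Zigzag S x y) :
    Good hQ ((id x).comp e) e (λ_ (real hQ e)).hom := by
  rintro s a a' b f f' χ χ' ⟨g, _, χ₂, ⟨θ, rfl⟩, p, rfl⟩ p'
  obtain ⟨b', h⟩ := Good.id e (θ.inv ≫ b) p p'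
  refine ⟨b', ?_⟩
  simp only [whiskerLeft_id, Category.id_comp] at h
  simp only [real, Category.assoc, h]
  rw [← comp_whiskerRight_assoc, Category.assoc, ← Q.map₂_comp, Iso.hom_inv_id_assoc]
  simp

theorem good_leftUnitor_inv {x y : K} (e : Zigzag S x y) :
    Good hQ e ((id x).comp e) (λ_ (real hQ e)).inv := by
  rintro s a a' b f f' χ χ' p ⟨g, _, χ₂, ⟨θ, rfl⟩, p', rfl⟩
  obtain ⟨b', h⟩ := Good.id e (b ≫ θ.hom) p p'
  refine ⟨b', ?_⟩
  simp only [whiskerLeft_id, Category.id_comp] at h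
  simp only [real, h]
  simp

theorem good_rightUnitor_hom {x y : K} (e : Zigzag S x y) :
    Good hQ (e.comp (id y)) e (ρ_ (real hQ e)).hom := by
  rintro s a a' b f f' χ χ' ⟨g, χ₁, _, p, ⟨θ, rfl⟩, rfl⟩ p'
  obtain ⟨b', h⟩ := Good.id e b p p'
  refine ⟨θ.inv ≫ b', ?_⟩
  simp only [whiskerLeft_id, Category.id_comp] at h
  have h' : Q.map₂ θ.hom ≫ Q.map₂ (θ.inv ≫ b') = Q.map₂ b' := by
    rw [← Q.map₂_comp, Iso.hom_inv_id_assoc]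
  simp only [real, Category.assoc, h']
  rw [rightUnitor_naturality_assoc, h]
  simp

theorem good_rightUnitor_inv {x y : K} (e : Zigzag S x y) :
    Good hQ e (e.comp (id y)) (ρ_ (real hQ e)).inv := by
  rintro s a a' b f f' χ χ' p ⟨g, χ₁, _, p', ⟨θ, rfl⟩, rfl⟩
  obtain ⟨b', h⟩ := Good.id e b p p'
  refine ⟨b' ≫ θ.hom, ?_⟩
  simp only [whiskerLeft_id, Category.id_comp] at h
  rw [Q.map₂_comp, reassoc_of% h]
  simp [real]

theorem good_map₂ {x y : K} {f g : x ⟶ y} (c : f ⟶ g) : Good hQ (of f) (of g) (Q.map₂ c) := by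
  rintro z a a' b h h' χ χ' ⟨θ, rfl⟩ ⟨θ', rfl⟩
  refine ⟨θ.inv ≫ b ▷ f ≫ a' ◁ c ≫ θ'.hom, ?_⟩
  have e : Q.map₂ θ.hom ≫ Q.map₂ (θ.inv ≫ b ▷ f ≫ a' ◁ c ≫ θ'.hom) =
      Q.map₂ (b ▷ f ≫ a' ◁ c ≫ θ'.hom) := by
    rw [← Q.map₂_comp, Iso.hom_inv_id_assoc]
  simp only [real, Category.assoc, e]
  simp

theorem good_mapId_hom (x : K) : Good hQ (of (𝟙 x)) (id x) (Q.mapId x).hom := by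
  rintro z a a' b h h' χ χ' ⟨θ, rfl⟩ ⟨θ', rfl⟩
  refine ⟨θ.inv ≫ b ▷ _ ≫ (ρ_ a').hom ≫ θ'.hom, ?_⟩
  have e : Q.map₂ θ.hom ≫ Q.map₂ (θ.inv ≫ b ▷ _ ≫ (ρ_ a').hom ≫ θ'.hom) =
      Q.map₂ (b ▷ _ ≫ (ρ_ a').hom ≫ θ'.hom) := by
    rw [← Q.map₂_comp, Iso.hom_inv_id_assoc]
  simp only [real, Category.assoc, e]
  simp only [Q.map₂_comp, Q.map₂_whisker_right, Q.map₂_right_unitor, Category.assoc,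
    Iso.inv_hom_id_assoc]

theorem good_mapId_inv (x : K) : Good hQ (id x) (of (𝟙 x)) (Q.mapId x).inv := by
  rintro z a a' b h h' χ χ' ⟨θ, rfl⟩ ⟨θ', rfl⟩
  refine ⟨θ.inv ≫ b ≫ (ρ_ a').inv ≫ θ'.hom, ?_⟩
  have e : Q.map₂ θ.hom ≫ Q.map₂ (θ.inv ≫ b ≫ (ρ_ a').inv ≫ θ'.hom) =
      Q.map₂ (b ≫ (ρ_ a').inv ≫ θ'.hom) := by
    rw [← Q.map₂_comp, Iso.hom_inv_id_assoc]
  simp only [real, Category.assoc, e]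
  simp [Q.mapComp_id_right_inv]

theorem good_mapComp_hom {x y z : K} (f : x ⟶ y) (g : y ⟶ z) :
    Good hQ (of (f ≫ g)) ((of f).comp (of g)) (Q.mapComp f g).hom := by
  rintro t a a' b h h' χ χ' ⟨θ, rfl⟩ ⟨k, _, _, ⟨θ₁, rfl⟩, ⟨θ₂, rfl⟩, rfl⟩
  refine ⟨θ.inv ≫ b ▷ _ ≫ (α_ _ _ _).inv ≫ θ₁.hom ▷ g ≫ θ₂.hom, ?_⟩
  have e : Q.map₂ θ.hom ≫ Q.map₂ (θ.inv ≫ b ▷ _ ≫ (α_ _ _ _).inv ≫ θ₁.hom ▷ g ≫ θ₂.hom) =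
      Q.map₂ (b ▷ _ ≫ (α_ _ _ _).inv ≫ θ₁.hom ▷ g ≫ θ₂.hom) := by
    rw [← Q.map₂_comp, Iso.hom_inv_id_assoc]
  simp only [real, Category.assoc, e]
  simp only [Q.map₂_comp, Q.map₂_whisker_right, Category.assoc, Iso.inv_hom_id_assoc,
    comp_whiskerRight]
  have e' : Q.map₂ (α_ a' f g).inv ≫ (Q.mapComp (a' ≫ f) g).hom =
      (Q.mapComp a' (f ≫ g)).hom ≫ Q.map a' ◁ (Q.mapComp f g).hom ≫ (α_ _ _ _).inv ≫
        (Q.mapComp a' f).inv ▷ Q.map g := by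
    rw [Q.mapComp_assoc_right_hom_assoc]
    simp
  rw [reassoc_of% e', Iso.inv_hom_id_assoc]

theorem good_mapComp_inv {x y z : K} (f : x ⟶ y) (g : y ⟶ z) :
    Good hQ ((of f).comp (of g)) (of (f ≫ g)) (Q.mapComp f g).inv := by
  rintro t a a' b h h' χ χ' ⟨k, _, _, ⟨θ₁, rfl⟩, ⟨θ₂, rfl⟩, rfl⟩ ⟨θ, rfl⟩
  refine ⟨θ₂.inv ≫ θ₁.inv ▷ g ≫ (α_ _ _ _).hom ≫ b ▷ _ ≫ θ.hom, ?_⟩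
  have e : Q.map₂ θ₁.hom ▷ Q.map g ≫ (Q.mapComp k g).inv ≫ Q.map₂ θ₂.hom ≫
        Q.map₂ (θ₂.inv ≫ θ₁.inv ▷ g ≫ (α_ _ _ _).hom ≫ b ▷ _ ≫ θ.hom) =
      (Q.mapComp _ g).inv ≫ Q.map₂ ((α_ _ _ _).hom ≫ b ▷ _ ≫ θ.hom) := by
    rw [← Q.map₂_comp, Iso.hom_inv_id_assoc, Q.map₂_comp (θ₁.inv ▷ g), Q.map₂_whisker_right,
      Category.assoc, Iso.inv_hom_id_assoc, Category.assoc, ← comp_whiskerRight_assoc,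
      ← Q.map₂_comp]
    simp
  simp only [real, Category.assoc, comp_whiskerRight, e]
  simp

theorem good_unit_hom {x y : K} (q : x ⟶ y) (hq : weakEquivalences S q) :
    Good hQ (id x) ((of q).comp (inv q hq)) (hQ q hq).unit.hom := by
  rintro t a a' b f f' χ χ' ⟨θ, rfl⟩ ⟨g, _, _, ⟨θ₁, rfl⟩, ⟨θ₂, rfl⟩, rfl⟩
  -- A presentation of `q` followed by its inverse makes `a' ≫ q` and `f' ≫ q` isomorphic; full
  -- faithfulness of `q` lifts this to `a' ⟶ f'`.
  obtain ⟨b', hb⟩ := (hq.1 a' f').2 (θ₁.hom ≫ θ₂.inv)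
  refine ⟨θ.inv ≫ b ≫ b', ?_⟩
  have e : Q.map₂ θ.hom ≫ Q.map₂ (θ.inv ≫ b ≫ b') = Q.map₂ (b ≫ b') := by
    rw [← Q.map₂_comp, Iso.hom_inv_id_assoc]
  have h : ((Q.mapComp a' q).inv ≫ Q.map₂ θ₁.hom) ≫ Q.map₂ θ₂.inv ≫ (Q.mapComp f' q).hom =
      Q.map₂ b' ▷ Q.map q := by
    have e' : b' ▷ q = _ := hb
    rw [Category.assoc, ← Q.map₂_comp_assoc, ← e', Q.map₂_whisker_right]
    simp
  simp only [real, Category.assoc, e]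
  rw [← comp_whiskerRight_assoc, h, associator_naturality_left_assoc, Iso.inv_hom_id_assoc,
    ← whisker_exchange_assoc, ← whisker_exchange_assoc, ← whisker_exchange_assoc,
    ← whiskerLeft_comp_assoc, Iso.hom_inv_id]
  simp

theorem good_unit_inv {x y : K} (q : x ⟶ y) (hq : weakEquivalences S q) :
    Good hQ ((of q).comp (inv q hq)) (id x) (hQ q hq).unit.inv := by
  rintro t a a' b f f' χ χ' ⟨g, _, _, ⟨θ₁, rfl⟩, ⟨θ₂, rfl⟩, rfl⟩ ⟨θ, rfl⟩
  obtain ⟨b', hb⟩ := (hq.1 f a').2 (θ₂.hom ≫ θ₁.inv ≫ b ▷ q)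
  refine ⟨b' ≫ θ.hom, ?_⟩
  have h : ((Q.mapComp a q).inv ≫ Q.map₂ θ₁.hom) ≫ (Q.map₂ θ₂.inv ≫ (Q.mapComp f q).hom) ≫
      Q.map₂ b' ▷ Q.map q = Q.map₂ b ▷ Q.map q := by
    have e' : b' ▷ q = _ := hb
    rw [← cancel_mono (Q.mapComp a' q).inv]
    simp only [Category.assoc]
    rw [← Q.map₂_whisker_right, e', ← Q.map₂_comp, ← Q.map₂_comp, Iso.inv_hom_id_assoc,
      Iso.hom_inv_id_assoc, Q.map₂_whisker_right, Iso.inv_hom_id_assoc]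
  simp only [real, Category.assoc, Q.map₂_comp]
  rw [← rightUnitor_naturality_assoc, whisker_exchange_assoc, ← associator_naturality_left_assoc,
    ← comp_whiskerRight_assoc (_ ≫ _) (Q.map₂ b' ▷ _), ← comp_whiskerRight_assoc, h]
  simp

theorem good_counit_hom {x y : K} (q : x ⟶ y) (hq : weakEquivalences S q) :
    Good hQ ((inv q hq).comp (of q)) (id y) (hQ q hq).counit.hom := by
  rintro t a a' b f f' χ χ' ⟨g, _, _, ⟨θ₁, rfl⟩, ⟨θ₂, rfl⟩, rfl⟩ ⟨θ, rfl⟩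
  -- Both `a` and `f` are isomorphic to `g ≫ q`, so no lifting through `q` is needed.
  refine ⟨θ₂.inv ≫ θ₁.hom ≫ b ≫ θ.hom, ?_⟩
  have h := (hQ q hq).whiskerRight_comp_counit (Q.map₂ θ₁.inv ≫ (Q.mapComp g q).hom)
  have e : Q.map₂ θ₁.inv ≫ Q.map₂ θ₂.hom ≫ Q.map₂ (θ₂.inv ≫ θ₁.hom ≫ b ≫ θ.hom) =
      Q.map₂ (b ≫ θ.hom) := by
    simp only [← Q.map₂_comp, Iso.hom_inv_id_assoc, Iso.inv_hom_id_assoc]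
  simp only [real, Category.assoc]
  rw [reassoc_of% h, Iso.hom_inv_id_assoc, e, ← whisker_exchange_assoc,
    rightUnitor_naturality_assoc, Q.map₂_comp]

theorem good_counit_inv {x y : K} (q : x ⟶ y) (hq : weakEquivalences S q) :
    Good hQ (id y) ((inv q hq).comp (of q)) (hQ q hq).counit.inv := by
  rintro t a a' b f f' χ χ' ⟨θ, rfl⟩ ⟨g, _, _, ⟨θ₁, rfl⟩, ⟨θ₂, rfl⟩, rfl⟩
  refine ⟨θ.inv ≫ b ≫ θ₁.inv ≫ θ₂.hom, ?_⟩
  have h := (hQ q hq).whiskerRight_comp_counit (Q.map₂ θ₁.inv ≫ (Q.mapComp g q).hom)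
  have e : Q.map₂ θ.hom ≫ Q.map₂ (θ.inv ≫ b ≫ θ₁.inv ≫ θ₂.hom) =
      Q.map₂ (b ≫ θ₁.inv ≫ θ₂.hom) := by
    rw [← Q.map₂_comp, Iso.hom_inv_id_assoc]
  simp only [real, Category.assoc, e]
  rw [reassoc_of% h]
  simp

end Zigzag

end TwoSite

/-! ### The bicategory of zigzags and its local smallness. -/

namespace TwoSite

variable {K : Type u} [Bicategory.{w, v} K] [Bicategory.Strict K] {S : StrictTwoSite K}
  {L : Type u'} [Bicategory.{w', v'} L] {Q : K ⥤ᵖ L}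

/-- The objects of `K`, as the objects of the bicategory of zigzags and good 2-arrows. -/
structure ZigzagBicat (hQ : Inverts (weakEquivalences S) Q) : Type (max u u') where
  /-- the underlying object of `K` -/
  obj : K

namespace ZigzagBicat

variable {hQ : Inverts (weakEquivalences S) Q}

/-- The 1-arrows of the bicategory of zigzags. -/
structure Hom (X Y : ZigzagBicat hQ) : Type (max u v v') where
  /-- the underlying zigzag -/
  zigzag : Zigzag S X.obj Y.obj

/-- The composite in `L` of a zigzag. -/
noncomputable abbrev Hom.real {X Y : ZigzagBicat hQ} (f : Hom X Y) : Q.obj X.obj ⟶ Q.obj Y.obj :=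
  f.zigzag.real hQ

/-- The 2-arrows of the bicategory of zigzags: the good 2-arrows of `L`. -/
@[ext]
structure Hom₂ {X Y : ZigzagBicat hQ} (f g : Hom X Y) : Type (max w w') where
  /-- the underlying 2-arrow of `L` -/
  cell : f.real ⟶ g.real
  good : Zigzag.Good hQ f.zigzag g.zigzag cell

noncomputable instance : CategoryStruct (ZigzagBicat hQ) where
  Hom := Hom
  id X := ⟨.id X.obj⟩
  comp f g := ⟨f.zigzag.comp g.zigzag⟩

noncomputable instance (X Y : ZigzagBicat hQ) : Category (X ⟶ Y) where
  Hom := Hom₂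
  id f := ⟨𝟙 f.real, .id _⟩
  comp a b := ⟨a.cell ≫ b.cell, a.good.comp b.good⟩
  id_comp _ := Hom₂.ext (Category.id_comp _)
  comp_id _ := Hom₂.ext (Category.comp_id _)
  assoc _ _ _ := Hom₂.ext (Category.assoc _ _ _)

/-- An invertible 2-arrow of zigzags from a good invertible 2-arrow with good inverse. -/
@[simps]
def isoMk {X Y : ZigzagBicat hQ} {f g : X ⟶ Y} (e : Hom.real f ≅ Hom.real g)
    (h : Zigzag.Good hQ f.zigzag g.zigzag e.hom) (h' : Zigzag.Good hQ g.zigzag f.zigzag e.inv) :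
    f ≅ g where
  hom := ⟨e.hom, h⟩
  inv := ⟨e.inv, h'⟩
  hom_inv_id := Hom₂.ext e.hom_inv_id
  inv_hom_id := Hom₂.ext e.inv_hom_id

noncomputable instance bicategory : Bicategory (ZigzagBicat hQ) where
  homCategory _ _ := inferInstance
  whiskerLeft f g h (a : Hom₂ g h) := Hom₂.mk (Hom.real f ◁ a.cell) (a.good.whiskerLeft _)
  whiskerRight {_ _ _ g h} (a : Hom₂ g h) f := Hom₂.mk (a.cell ▷ Hom.real f) (a.good.whiskerRight _)
  associator f g h := isoMk (f := (f ≫ g) ≫ h) (g := f ≫ g ≫ h)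
    (α_ (Hom.real f) (Hom.real g) (Hom.real h))
    (Zigzag.good_associator_hom hQ _ _ _) (Zigzag.good_associator_inv hQ _ _ _)
  leftUnitor f := isoMk (f := 𝟙 _ ≫ f) (g := f) (λ_ (Hom.real f))
    (Zigzag.good_leftUnitor_hom hQ _) (Zigzag.good_leftUnitor_inv hQ _)
  rightUnitor f := isoMk (f := f ≫ 𝟙 _) (g := f) (ρ_ (Hom.real f))
    (Zigzag.good_rightUnitor_hom hQ _) (Zigzag.good_rightUnitor_inv hQ _)
  whiskerLeft_id _ _ := Hom₂.ext (whiskerLeft_id _ _)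
  whiskerLeft_comp _ _ _ _ _ _ := Hom₂.ext (whiskerLeft_comp _ _ _)
  id_whiskerLeft _ := Hom₂.ext (id_whiskerLeft _)
  comp_whiskerLeft _ _ _ _ _ := Hom₂.ext (comp_whiskerLeft _ _ _)
  id_whiskerRight _ _ := Hom₂.ext (id_whiskerRight _ _)
  comp_whiskerRight _ _ _ := Hom₂.ext (comp_whiskerRight _ _ _)
  whiskerRight_id _ := Hom₂.ext (whiskerRight_id _)
  whiskerRight_comp _ _ _ := Hom₂.ext (whiskerRight_comp _ _ _)
  whisker_assoc _ _ _ _ _ := Hom₂.ext (whisker_assoc _ _ _)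
  whisker_exchange _ _ := Hom₂.ext (whisker_exchange _ _)
  pentagon _ _ _ _ := Hom₂.ext (pentagon _ _ _ _)
  triangle _ _ := Hom₂.ext (triangle _ _)

variable (hQ) in
/-- The 1-arrow of the bicategory of zigzags given by a zigzag. -/
abbrev mkHom {x y : K} (e : Zigzag S x y) : (⟨x⟩ : ZigzagBicat hQ) ⟶ ⟨y⟩ := Hom.mk e

/-- The 2-arrow of the bicategory of zigzags given by a good 2-arrow. -/
abbrev mkHom₂ {X Y : ZigzagBicat hQ} {f g : X ⟶ Y} (a : Hom.real f ⟶ Hom.real g)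
    (h : Zigzag.Good hQ f.zigzag g.zigzag a) : f ⟶ g := Hom₂.mk a h

/-- Over a common cover presenting both zigzags, a good 2-arrow is determined by any witness in `K`:
`χ'` is invertible and `Q` of the cover is an equivalence. Witnesses need not be unique, so `Q` need
not be faithful on 2-arrows. -/
theorem small_hom₂ (hK : LocallyEssentiallySmall.{s} K) {X Y : ZigzagBicat hQ} (f g : X ⟶ Y) :
    Small.{s} (f ⟶ g) := by
  obtain ⟨z, c, f', χ, hc, p⟩ := Zigzag.exists_pres hQ f.zigzag
  obtain ⟨t, q, g', χ', hq, p'⟩ := Zigzag.exists_pres_over hQ g.zigzag c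
  have := hK t Y.obj
  choose b hb using fun a : Hom₂ f g => a.good (𝟙 _) (p.pull q) p'
  refine small_of_injective (f := b) fun a a' h => Hom₂.ext ?_
  have e := (hb a).symm.trans ((congrArg (fun b => _ ≫ Q.map₂ b) h).trans (hb a'))
  have := p'.isIso
  simp only [cancel_mono, Q.map₂_id, id_whiskerRight, Category.id_comp] at e
  exact (hQ _ (S.weakEquivalences_of_mem (S.comp_mem _ _ hq hc))).whiskerLeft_cancel e

/-- Conjugating `Q e` by the presentations gives an isomorphism over the cover `c`. It descends to
`L` because `Q c` is an equivalence, and it is good by `good_of_pres`. -/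
theorem nonempty_iso_of_pres {X Y : ZigzagBicat hQ} {f g : X ⟶ Y} {z : K} {c : z ⟶ X.obj}
    (hc : S.J c) {f' g' : z ⟶ Y.obj} {χ : Q.map c ≫ Hom.real f ⟶ Q.map f'}
    {χ' : Q.map c ≫ Hom.real g ⟶ Q.map g'} (p : Zigzag.Pres hQ f.zigzag c f' χ)
    (p' : Zigzag.Pres hQ g.zigzag c g' χ') (e : f' ≅ g') : Nonempty (f ≅ g) := by
  have hi := p.isIso
  have hi' := p'.isIso
  have hq := hQ _ (S.weakEquivalences_of_mem hc)
  obtain ⟨a, ha⟩ := (hq.whiskerLeft_bijective (Hom.real f) (Hom.real g)).2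
    (χ ≫ Q.map₂ e.hom ≫ inv χ')
  obtain ⟨a', ha'⟩ := (hq.whiskerLeft_bijective (Hom.real g) (Hom.real f)).2
    (χ' ≫ Q.map₂ e.inv ≫ inv χ)
  dsimp only at ha ha'
  refine ⟨isoMk (f := f) (g := g) ⟨a, a', hq.whiskerLeft_cancel ?_, hq.whiskerLeft_cancel ?_⟩
    (Zigzag.good_of_pres hc p p' e.hom ?_) (Zigzag.good_of_pres hc p' p e.inv ?_)⟩
  · simp [ha, ha', PrelaxFunctor.map₂_hom_inv_assoc]
  · simp [ha, ha', PrelaxFunctor.map₂_inv_hom_assoc]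
  · simp [ha]
  · simp [ha']

theorem locallyEssentiallySmall (hK : LocallyEssentiallySmall.{s} K) (hW : WISC.{s} S) :
    LocallyEssentiallySmall.{s} (ZigzagBicat hQ) := by
  intro X Y
  obtain ⟨I, c, p, hp, H⟩ := hW X.obj
  have key : ∀ f : X ⟶ Y, ∃ (i : I) (f' : c i ⟶ Y.obj) (χ : Q.map (p i) ≫ Hom.real f ⟶ Q.map f'),
      Zigzag.Pres hQ f.zigzag (p i) f' χ := by
    intro f
    obtain ⟨z, j, f', χ, hj, h⟩ := Zigzag.exists_pres hQ f.zigzag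
    obtain ⟨i, a, ha⟩ := H z j hj
    have h' : ∃ (f'' : c i ⟶ Y.obj) (χ' : Q.map (a ≫ j) ≫ Hom.real f ⟶ Q.map f''),
      Zigzag.Pres hQ f.zigzag (a ≫ j) f'' χ' := ⟨_, _, h.pull a⟩
    rw [ha] at h'
    exact ⟨i, h'⟩
  -- The invariant of a zigzag, as for fractions: a weakly initial cover presenting it, and the
  -- isomorphism class of the presenting arrow.
  choose i r χ hr using key
  have := fun z : K => hK z Y.obj
  refine essentiallySmall_of_invariant (small_hom₂ hK) (T := Σ i, Skeleton (c i ⟶ Y.obj))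
    (fun f => ⟨i f, toSkeleton (r f)⟩) fun f g h => ?_
  have key₂ : ∀ (j : I) (g' : c j ⟶ Y.obj) (χ' : Q.map (p j) ≫ Hom.real g ⟶ Q.map g'),
      Zigzag.Pres hQ g.zigzag (p j) g' χ' →
      (⟨i f, toSkeleton (r f)⟩ : Σ i, Skeleton (c i ⟶ Y.obj)) = ⟨j, toSkeleton g'⟩ →
      Nonempty (f ≅ g) := by
    intro j g' χ' h' e
    obtain rfl : i f = j := congrArg Sigma.fst e
    have : toSkeleton (r f) = toSkeleton g' := by simpa using e
    obtain ⟨e'⟩ := toSkeleton_eq_toSkeleton_iff.1 this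
    exact nonempty_iso_of_pres (hp _) (hr f) h' e'
  exact key₂ _ _ _ (hr g) h

variable (hQ) in
/-- The canonical pseudofunctor from `K` to the bicategory of zigzags. -/
noncomputable def ofBase : K ⥤ᵖ ZigzagBicat hQ where
  obj x := ⟨x⟩
  map f := mkHom hQ (.of f)
  map₂ {_ _ f g} a := mkHom₂ (f := mkHom hQ (.of f)) (g := mkHom hQ (.of g)) (Q.map₂ a)
    (Zigzag.good_map₂ hQ a)
  map₂_id _ := Hom₂.ext (Q.map₂_id _)
  map₂_comp _ _ := Hom₂.ext (Q.map₂_comp _ _)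
  mapId x := isoMk (f := mkHom hQ (.of (𝟙 x))) (g := mkHom hQ (.id x)) (Q.mapId x)
    (Zigzag.good_mapId_hom hQ x) (Zigzag.good_mapId_inv hQ x)
  mapComp f g := isoMk (f := mkHom hQ (.of (f ≫ g))) (g := mkHom hQ (.comp (.of f) (.of g)))
    (Q.mapComp f g) (Zigzag.good_mapComp_hom hQ f g)
    (Zigzag.good_mapComp_inv hQ f g)
  map₂_whisker_left _ _ _ _ := Hom₂.ext (Q.map₂_whisker_left _ _)
  map₂_whisker_right _ _ := Hom₂.ext (Q.map₂_whisker_right _ _)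
  map₂_associator _ _ _ := Hom₂.ext (Q.map₂_associator _ _ _)
  map₂_left_unitor _ := Hom₂.ext (Q.map₂_left_unitor _)
  map₂_right_unitor _ := Hom₂.ext (Q.map₂_right_unitor _)

theorem inverts_ofBase : Inverts (weakEquivalences S) (ofBase hQ) := fun x y q hq =>
  ⟨mkHom hQ (.inv q hq),
    ⟨isoMk (f := mkHom hQ (.comp (.of q) (.inv q hq))) (g := mkHom hQ (.id x))
      (hQ q hq).unit.symm (Zigzag.good_unit_inv hQ q hq) (Zigzag.good_unit_hom hQ q hq)⟩,
    ⟨isoMk (f := mkHom hQ (.comp (.inv q hq) (.of q))) (g := mkHom hQ (.id y))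
      (hQ q hq).counit (Zigzag.good_counit_hom hQ q hq) (Zigzag.good_counit_inv hQ q hq)⟩⟩

end ZigzagBicat

end TwoSite

/-! ### Retracts of pseudofunctors, the copy of `L`, and realisation of zigzags. -/

namespace TwoSite

open scoped Pseudofunctor.StrongTrans

section Retracts

variable {B : Type*} [Bicategory B] {C : Type*} [Bicategory C] {F F' : B ⥤ᵖ C}

/-- The components of an invertible modification to an identity. -/
@[simps]
def appIsoOfRetract {θ : F ⟶ F'} {η : F' ⟶ F} (e : θ ≫ η ≅ 𝟙 F) (a : B) :
    θ.app a ≫ η.app a ≅ 𝟙 (F.obj a) where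
  hom := e.hom.as.app a
  inv := e.inv.as.app a
  hom_inv_id := congrArg (fun m => m.as.app a) e.hom_inv_id
  inv_hom_id := congrArg (fun m => m.as.app a) e.inv_hom_id

/-- A retraction between pseudofunctors induces retractions between the functors on
hom-categories. -/
def mapFunctorIsoOfRetract {θ : F ⟶ F'} {η : F' ⟶ F} (e : θ ≫ η ≅ 𝟙 F) (a b : B) :
    F'.mapFunctor a b ⋙ postcomp _ (η.app b) ⋙ precomp _ (θ.app a) ≅ F.mapFunctor a b :=
  NatIso.ofComponents
    (fun f => whiskerLeftIso (θ.app a) (η.naturality f) ≪≫ (α_ _ _ _).symm ≪≫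
      whiskerRightIso (appIsoOfRetract e a) (F.map f) ≪≫ λ_ (F.map f))
    (fun {f g} k => by
      let m := (appIsoOfRetract e a).hom
      change θ.app a ◁ F'.map₂ k ▷ η.app b ≫ θ.app a ◁ (η.naturality g).hom ≫
          (α_ _ _ _).inv ≫ m ▷ F.map g ≫ (λ_ (F.map g)).hom =
        (θ.app a ◁ (η.naturality f).hom ≫
          (α_ _ _ _).inv ≫ m ▷ F.map f ≫ (λ_ (F.map f)).hom) ≫ F.map₂ k
      rw [← whiskerLeft_comp_assoc, η.naturality_naturality, whiskerLeft_comp, Category.assoc,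
        associator_inv_naturality_right_assoc, whisker_exchange_assoc, leftUnitor_naturality]
      simp only [Category.assoc])

end Retracts

section Comp

variable {B : Type*} [Bicategory B] {C : Type*} [Bicategory C]

theorem pseudofunctor_ext {F G : B ⥤ᵖ C} (h : F.toPrelaxFunctor = G.toPrelaxFunctor)
    (h₁ : F.mapId ≍ G.mapId) (h₂ : @F.mapComp ≍ @G.mapComp) : F = G := by
  cases F
  cases G
  cases h
  cases h₁
  cases h₂
  rfl

/-- Objects, 1-arrows and 2-arrows agree by definition; the constraints differ by functoriality of
`H` on 2-arrows and reassociation. A strict equality allows rewriting in the types of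
transformations. -/
theorem pseudofunctor_comp_assoc {D : Type*} [Bicategory D] {E : Type*} [Bicategory E]
    (F : B ⥤ᵖ C) (G : C ⥤ᵖ D) (H : D ⥤ᵖ E) : (F.comp G).comp H = F.comp (G.comp H) :=
  pseudofunctor_ext rfl
    (heq_of_eq (funext fun a => Iso.ext
      ((congrArg (· ≫ (H.mapId (G.obj (F.obj a))).hom)
        (H.map₂_comp (G.map₂ (F.mapId a).hom) (G.mapId (F.obj a)).hom)).trans
          (Category.assoc _ _ _))))
    (heq_of_eq (funext fun _ => funext fun _ => funext fun _ => funext fun f => funext fun g =>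
      Iso.ext
        ((congrArg (· ≫ (H.mapComp (G.map (F.map f)) (G.map (F.map g))).hom)
          (H.map₂_comp (G.map₂ (F.mapComp f g).hom) (G.mapComp (F.map f) (F.map g)).hom)).trans
            (Category.assoc _ _ _))))

end Comp

variable {K : Type u} [Bicategory.{w, v} K] [Bicategory.Strict K] {S : StrictTwoSite K}
  {L : Type u'} [Bicategory.{w', v'} L]

/-- A copy of `L` in the universe levels of the bicategory of zigzags. -/
structure TargetLift (Q : K ⥤ᵖ L) : Type (max u u') where
  /-- the underlying object of `L` -/
  obj : L

namespace TargetLift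

variable {Q : K ⥤ᵖ L}

/-- The 1-arrows of the lifted copy of `L`. -/
structure Hom (X Y : TargetLift Q) : Type (max u v v') where
  /-- the underlying 1-arrow of `L` -/
  hom : X.obj ⟶ Y.obj

/-- The 2-arrows of the lifted copy of `L`. -/
@[ext]
structure Hom₂ {X Y : TargetLift Q} (f g : Hom X Y) : Type (max w w') where
  /-- the underlying 2-arrow of `L` -/
  cell : f.hom ⟶ g.hom

instance : CategoryStruct (TargetLift Q) where
  Hom := Hom
  id X := ⟨𝟙 X.obj⟩
  comp f g := ⟨f.hom ≫ g.hom⟩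

instance (X Y : TargetLift Q) : Category (X ⟶ Y) where
  Hom := Hom₂
  id f := ⟨𝟙 f.hom⟩
  comp a b := ⟨a.cell ≫ b.cell⟩
  id_comp _ := Hom₂.ext (Category.id_comp _)
  comp_id _ := Hom₂.ext (Category.comp_id _)
  assoc _ _ _ := Hom₂.ext (Category.assoc _ _ _)

/-- An invertible 2-arrow of the lifted copy of `L`. -/
@[simps]
def isoMk {X Y : TargetLift Q} {f g : X ⟶ Y} (e : Hom.hom f ≅ Hom.hom g) : f ≅ g where
  hom := ⟨e.hom⟩
  inv := ⟨e.inv⟩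
  hom_inv_id := Hom₂.ext e.hom_inv_id
  inv_hom_id := Hom₂.ext e.inv_hom_id

instance bicategory : Bicategory (TargetLift Q) where
  homCategory _ _ := inferInstance
  whiskerLeft f g h (a : Hom₂ g h) := Hom₂.mk (Hom.hom f ◁ a.cell)
  whiskerRight {_ _ _ g h} (a : Hom₂ g h) f := Hom₂.mk (a.cell ▷ Hom.hom f)
  associator f g h := isoMk (f := (f ≫ g) ≫ h) (g := f ≫ g ≫ h)
    (α_ (Hom.hom f) (Hom.hom g) (Hom.hom h))
  leftUnitor f := isoMk (f := 𝟙 _ ≫ f) (g := f) (λ_ (Hom.hom f))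
  rightUnitor f := isoMk (f := f ≫ 𝟙 _) (g := f) (ρ_ (Hom.hom f))
  whiskerLeft_id _ _ := Hom₂.ext (whiskerLeft_id _ _)
  whiskerLeft_comp _ _ _ _ _ _ := Hom₂.ext (whiskerLeft_comp _ _ _)
  id_whiskerLeft _ := Hom₂.ext (id_whiskerLeft _)
  comp_whiskerLeft _ _ _ _ _ := Hom₂.ext (comp_whiskerLeft _ _ _)
  id_whiskerRight _ _ := Hom₂.ext (id_whiskerRight _ _)
  comp_whiskerRight _ _ _ := Hom₂.ext (comp_whiskerRight _ _ _)
  whiskerRight_id _ := Hom₂.ext (whiskerRight_id _)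
  whiskerRight_comp _ _ _ := Hom₂.ext (whiskerRight_comp _ _ _)
  whisker_assoc _ _ _ _ _ := Hom₂.ext (whisker_assoc _ _ _)
  whisker_exchange _ _ := Hom₂.ext (whisker_exchange _ _)
  pentagon _ _ _ _ := Hom₂.ext (pentagon _ _ _ _)
  triangle _ _ := Hom₂.ext (triangle _ _)

/-- The 1-arrow of the lifted copy of `L` given by a 1-arrow of `L`. -/
abbrev mkHom (Q : K ⥤ᵖ L) {x y : L} (f : x ⟶ y) : (⟨x⟩ : TargetLift Q) ⟶ ⟨y⟩ := Hom.mk f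

/-- The 2-arrow of the lifted copy of `L` given by a 2-arrow of `L`. -/
abbrev mkHom₂ {X Y : TargetLift Q} {f g : X ⟶ Y} (a : Hom.hom f ⟶ Hom.hom g) : f ⟶ g := Hom₂.mk a

variable (Q) in
/-- The equivalence from `L` to its lifted copy. -/
def lift : L ⥤ᵖ TargetLift Q where
  obj x := ⟨x⟩
  map f := mkHom Q f
  map₂ {_ _ f g} a := mkHom₂ (f := mkHom Q f) (g := mkHom Q g) a
  map₂_id _ := rfl
  map₂_comp _ _ := rfl
  mapId _ := Iso.refl _
  mapComp _ _ := Iso.refl _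
  map₂_whisker_left f g h a := Hom₂.ext (by
    change f ◁ a = 𝟙 _ ≫ f ◁ a ≫ 𝟙 _
    simp)
  map₂_whisker_right a f := Hom₂.ext (by
    change a ▷ f = 𝟙 _ ≫ a ▷ f ≫ 𝟙 _
    simp)
  map₂_associator f g h := Hom₂.ext (by
    change (α_ f g h).hom = 𝟙 _ ≫ 𝟙 _ ▷ h ≫ (α_ f g h).hom ≫ f ◁ 𝟙 _ ≫ 𝟙 _
    simp)
  map₂_left_unitor f := Hom₂.ext (by
    change (λ_ f).hom = 𝟙 _ ≫ 𝟙 _ ▷ f ≫ (λ_ f).hom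
    simp)
  map₂_right_unitor f := Hom₂.ext (by
    change (ρ_ f).hom = 𝟙 _ ≫ f ◁ 𝟙 _ ≫ (ρ_ f).hom
    simp)

end TargetLift

namespace ZigzagBicat

variable {Q : K ⥤ᵖ L} {hQ : Inverts (weakEquivalences S) Q}

variable (hQ) in
/-- The pseudofunctor sending a zigzag to its composite. -/
noncomputable def toTarget : ZigzagBicat hQ ⥤ᵖ TargetLift Q where
  obj X := ⟨Q.obj X.obj⟩
  map f := TargetLift.mkHom Q (Hom.real f)
  map₂ {_ _ f g} a := TargetLift.mkHom₂ (f := TargetLift.mkHom Q (Hom.real f))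
    (g := TargetLift.mkHom Q (Hom.real g)) (Hom₂.cell a)
  map₂_id _ := rfl
  map₂_comp _ _ := rfl
  mapId _ := Iso.refl _
  mapComp _ _ := Iso.refl _
  map₂_whisker_left f _ _ a := TargetLift.Hom₂.ext (by
    change Hom.real f ◁ Hom₂.cell a = 𝟙 _ ≫ Hom.real f ◁ Hom₂.cell a ≫ 𝟙 _
    simp)
  map₂_whisker_right a f := TargetLift.Hom₂.ext (by
    change Hom₂.cell a ▷ Hom.real f = 𝟙 _ ≫ Hom₂.cell a ▷ Hom.real f ≫ 𝟙 _
    simp)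
  map₂_associator f g h := TargetLift.Hom₂.ext (by
    change (α_ (Hom.real f) (Hom.real g) (Hom.real h)).hom =
      𝟙 _ ≫ 𝟙 _ ▷ _ ≫ (α_ (Hom.real f) (Hom.real g) (Hom.real h)).hom ≫ _ ◁ 𝟙 _ ≫ 𝟙 _
    simp)
  map₂_left_unitor f := TargetLift.Hom₂.ext (by
    change (λ_ (Hom.real f)).hom = 𝟙 _ ≫ 𝟙 _ ▷ _ ≫ (λ_ (Hom.real f)).hom
    simp)
  map₂_right_unitor f := TargetLift.Hom₂.ext (by
    change (ρ_ (Hom.real f)).hom = 𝟙 _ ≫ _ ◁ 𝟙 _ ≫ (ρ_ (Hom.real f)).hom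
    simp)

variable {F F' : K ⥤ᵖ ZigzagBicat hQ}

/-- Postcomposition of a pseudonatural transformation with `toTarget`. -/
noncomputable def postcompTrans (σ : F ⟶ F') : F.comp (toTarget hQ) ⟶ F'.comp (toTarget hQ) where
  app x := (toTarget hQ).map (σ.app x)
  naturality f := (toTarget hQ).map₂Iso (σ.naturality f)
  naturality_naturality a :=
    TargetLift.Hom₂.ext (congrArg Hom₂.cell (σ.naturality_naturality a))
  naturality_id x := by
    change (toTarget hQ).map₂ (σ.naturality (𝟙 x)).hom ≫
      _ ◁ ((toTarget hQ).map₂ (F'.mapId x).hom ≫ 𝟙 _) =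
      ((toTarget hQ).map₂ (F.mapId x).hom ≫ 𝟙 _) ▷ _ ≫ _
    rw [Category.comp_id, Category.comp_id]
    exact TargetLift.Hom₂.ext (congrArg Hom₂.cell (σ.naturality_id x))
  naturality_comp f g := by
    change (toTarget hQ).map₂ (σ.naturality (f ≫ g)).hom ≫
      _ ◁ ((toTarget hQ).map₂ (F'.mapComp f g).hom ≫ 𝟙 _) =
      ((toTarget hQ).map₂ (F.mapComp f g).hom ≫ 𝟙 _) ▷ _ ≫ _
    rw [Category.comp_id, Category.comp_id]
    exact TargetLift.Hom₂.ext (congrArg Hom₂.cell (σ.naturality_comp f g))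

/-- Postcomposition with `toTarget` preserves retractions. -/
noncomputable def postcompRetract {σ : F ⟶ F'} {τ : F' ⟶ F} (e : σ ≫ τ ≅ 𝟙 F) :
    postcompTrans σ ≫ postcompTrans τ ≅ 𝟙 (F.comp (toTarget hQ)) :=
  Pseudofunctor.StrongTrans.isoMk (fun x => (toTarget hQ).map₂Iso (appIsoOfRetract e x))
    (fun f => TargetLift.Hom₂.ext (congrArg Hom₂.cell (e.hom.as.naturality f)))

end ZigzagBicat

/-- The retraction underlying an equivalence in an induced bicategory. -/
def retractOfEquivalence {B : Type*} {C : Type*} [Bicategory C] {F : B → C}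
    {X Y : InducedBicategory C F} (E : X ≌ Y) : E.inv.hom ≫ E.hom.hom ≅ 𝟙 (F Y) where
  hom := E.counit.hom.hom
  inv := E.counit.inv.hom
  hom_inv_id := congrArg (·.hom) E.counit.hom_inv_id
  inv_hom_id := congrArg (·.hom) E.counit.inv_hom_id

/-- A retraction between restrictions to `B` of pseudofunctors on a localisation of `B` extends to
the localisation. -/
theorem exists_retract {B : Type*} [Bicategory B] {L : Type*} [Bicategory L] {A : Type*}
    [Bicategory A] {W : ArrowClass B} {Q : B ⥤ᵖ L} (hQ : Inverts W Q)
    (h : IsBiequivalence (precomposition hQ A)) {F F' : L ⥤ᵖ A} (θ : Q.comp F ⟶ Q.comp F')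
    (η : Q.comp F' ⟶ Q.comp F) (e : θ ≫ η ≅ 𝟙 (Q.comp F)) :
    ∃ (θ' : F ⟶ F') (η' : F' ⟶ F), Nonempty (θ' ≫ η' ≅ 𝟙 F) := by
  let P := precomposition hQ A
  -- Essential surjectivity on hom-categories extends `θ` and `η`; full faithfulness extends the
  -- isomorphism.
  have hFF := h.2 F F
  have h₁ := h.2 F F'
  have h₂ := h.2 F' F
  let θ₀ : P.obj F ⟶ P.obj F' := InducedBicategory.mkHom θ
  let η₀ : P.obj F' ⟶ P.obj F := InducedBicategory.mkHom η
  let e₀ : θ₀ ≫ η₀ ≅ 𝟙 (P.obj F) := InducedBicategory.isoMk e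
  let i₁ : P.map ((P.mapFunctor F F').objPreimage θ₀) ≅ θ₀ :=
    (P.mapFunctor F F').objObjPreimageIso θ₀
  let i₂ : P.map ((P.mapFunctor F' F).objPreimage η₀) ≅ η₀ :=
    (P.mapFunctor F' F).objObjPreimageIso η₀
  exact ⟨_, _, ⟨(P.mapFunctor F F).preimageIso
    (P.mapComp _ _ ≪≫ whiskerRightIso i₁ _ ≪≫ whiskerLeftIso _ i₂ ≪≫ e₀ ≪≫ (P.mapId F).symm)⟩⟩

/-- On hom-categories the fully faithful `F` factors through `G` up to isomorphism, so `G` is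
injective on 2-arrows and isomorphic images under `G` come from isomorphic 1-arrows. -/
theorem locallyEssentiallySmall_of_retract {B : Type*} [Bicategory B] {C : Type*} [Bicategory C]
    {A : Type*} [Bicategory A] (hC : LocallyEssentiallySmall.{s} C) (G : B ⥤ᵖ C) (I : C ⥤ᵖ A)
    (F : B ⥤ᵖ A) (hF : ∀ a b, (F.mapFunctor a b).FullyFaithful) {θ : F ⟶ G.comp I}
    {η : G.comp I ⟶ F} (e : θ ≫ η ≅ 𝟙 F) : LocallyEssentiallySmall.{s} B := by
  intro a b
  have := hC (G.obj a) (G.obj b)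
  let T := postcomp _ (η.app b) ⋙ precomp _ (θ.app a)
  let i : (G.comp I).mapFunctor a b ⋙ T ≅ F.mapFunctor a b := mapFunctorIsoOfRetract e a b
  refine essentiallySmall_of_invariant (T := Skeleton (G.obj a ⟶ G.obj b)) (fun f g => ?_)
    (fun f => toSkeleton (G.map f)) (fun f g h => ?_)
  · refine small_of_injective (f := fun k : f ⟶ g => G.map₂ k) fun k k' h => ?_
    refine (hF a b).map_injective ((cancel_epi (i.hom.app f)).1 ?_)
    rw [← i.hom.naturality, ← i.hom.naturality]
    exact congrArg (fun t => T.map (I.map₂ t) ≫ _) h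
  · obtain ⟨j⟩ := toSkeleton_eq_toSkeleton_iff.1 h
    exact ⟨(hF a b).preimageIso
      (i.symm.app f ≪≫ T.mapIso (I.map₂Iso j) ≪≫ i.app g)⟩

end TwoSite

/-! ### The theorem. -/

open scoped Pseudofunctor.StrongTrans

theorem mainTheorem5 {K : Type u} [Bicategory.{w, v} K] [Bicategory.Strict K]
    (S : TwoSite.StrictTwoSite K)
    (hK : TwoSite.LocallyEssentiallySmall.{s} K)
    (hW : TwoSite.WISC.{s} S) :
    TwoSite.FractionsLocallyEssentiallySmall.{s} S ∧
      ∀ (L : Type u') [Bicategory.{w', v'} L] (Q : K ⥤ᵖ L),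
        TwoSite.IsLocalisation.{max u u', max u v v', max w w'}
          (TwoSite.weakEquivalences S) Q →
        TwoSite.LocallyEssentiallySmall.{s} L := by
  refine ⟨TwoSite.Fraction.essentiallySmall hK hW, fun L _ Q ⟨hQ, h⟩ => ?_⟩
  -- The universal property at the bicategory of zigzags extends `ofBase` along `Q` up to
  -- equivalence.
  obtain ⟨G, ⟨E⟩⟩ := (h (TwoSite.ZigzagBicat hQ)).1
    ⟨TwoSite.ZigzagBicat.ofBase hQ, TwoSite.ZigzagBicat.inverts_ofBase⟩
  let I := TwoSite.ZigzagBicat.toTarget hQ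
  have H : ∃ (θ : Q.comp (TwoSite.TargetLift.lift Q) ⟶ Q.comp (G.comp I))
      (η : Q.comp (G.comp I) ⟶ Q.comp (TwoSite.TargetLift.lift Q)), Nonempty (θ ≫ η ≅ 𝟙 _) := by
    rw [← TwoSite.pseudofunctor_comp_assoc]
    -- Realising `ofBase` gives back `Q` followed by `lift`, by definition.
    exact ⟨_, _, ⟨TwoSite.ZigzagBicat.postcompRetract (TwoSite.retractOfEquivalence E)⟩⟩
  obtain ⟨θ, η, ⟨e'⟩⟩ := H
  obtain ⟨θ', η', ⟨e''⟩⟩ := TwoSite.exists_retract hQ (h (TwoSite.TargetLift Q)) θ η e'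
  exact TwoSite.locallyEssentiallySmall_of_retract
    (TwoSite.ZigzagBicat.locallyEssentiallySmall hK hW) G I (TwoSite.TargetLift.lift Q)
    (fun a b => ⟨fun k => k.cell, fun _ => rfl, fun _ => rfl⟩) e''
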